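/- Let $n,m\ge 1$, $L\ge 0$, $\sigma>0$, $\mu\in\mathbb R^n$, and let $y=\mu+\varepsilon$ with $\varepsilon\sim N(0,\sigma^2 I_n)$. Let $\hat\mu^{(1)},\dots,\hat\mu^{(m)}:\mathbb R^n\to\mathbb R^n$ be $L$-Lipschitz for the Euclidean norm, and write $\hat\mu^{(j)}$ for $\hat\mu^{(j)}(y)$. Let $\nabla\hat\mu^{(j)}$ be the matrix with entries $\partial \hat\mu^{(j)}_i/\partial y_a$ (row $a$, column $i$) at $y$, which exists almost surely, let $$\mathsf{SURE}^{(j)}=\|\hat\mu^{(j)}-y\|^2+2\sigma^2\operatorname{trace}\nabla\hat\mu^{(j)}-n\sigma^2,$$ and let $\tilde\mu=\hat\mu^{(\hat k)}$, where $\hat k\in\arg\min_{j\in[m]}\mathsf{SURE}^{(j)}$ (ties broken in any measurable way). Let $j_0\in\arg\min_{j\in[m]}\mathbb E\|\hat\mu^{(j)}-\mu\|$ and $s^*=\max_{k\in[m]}\mathbb E\big[\operatorname{trace}\big((\nabla\hat\mu^{(k)}-\nabla\hat\mu^{(j_0)})^2\big)\big]$. Then: (i) For every $\alpha\in(0,1)$,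 with probability at least $1-\alpha$, $$\|\tilde\mu-\mu\|-\|\hat\mu^{(j_0)}-\mu\|\le\sigma\max\big\{(8s^*m/\alpha)^{1/4},\,(8m(\sqrt2L+1)/\alpha)^{1/2}\big\}.$$ (ii) For every $\delta\in(0,1)$, with probability at least $1-\delta$, $$\|\hat\mu^{(j_0)}-\mu\|-\min_{j\in[m]}\|\hat\mu^{(j)}-\mu\|\le 2L\sigma\sqrt{2\log(m/\delta)}.$$ Consequently, for all $\alpha,\delta\in(0,1)$, with probability at least $1-\alpha-\delta$, $\|\tilde\mu-\mu\|-\min_{j\in[m]}\|\hat\mu^{(j)}-\mu\|$ is at most the sum of the right-hand sides of (i) and (ii). (iii) For some absolute constant $C>0$ (independent of all the data above), $$\mathbb E\Big[\big(\|\tilde\mu-\mu\|-\min_{j\in[m]}\|\hat\mu^{(j)}-\mu\|\big)^2\Big]^{1/2}\le C\sigma\big[(s^*m)^{1/4}+(1+L)m^{1/2}\big].$$ (iv) If $\max_{j\in[m]}\mathbb E[\|\hat\mu^{(j)}-\mu\|^2]/n\le L^2\sigma^2$ (which holds in particular if $L\ge1$ and the left-hand side is at most $L\sigma^2$), then $$\mathbb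 E[\|\tilde\mu-\mu\|^2]-\min_{j\in[m]}\mathbb E[\|\hat\mu^{(j)}-\mu\|^2]\le L\sigma^2(32nm)^{1/2}.$$ -/

import Mathlib

open MeasureTheory ProbabilityTheory
open scoped NNReal

/-- The matrix `∇f(y)` whose `i`-th column is the gradient of the `i`-th component of `f` at `y`:
its `(a, i)` entry is `∂f_i/∂y_a`. A Lipschitz `f` is differentiable Lebesgue-almost everywhere, so
the value at the exceptional points plays no role. -/
noncomputable def gradMatrix {n : ℕ}
    (f : EuclideanSpace ℝ (Fin n) → EuclideanSpace ℝ (Fin n)) (y : EuclideanSpace ℝ (Fin n)) :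
    Matrix (Fin n) (Fin n) ℝ :=
  Matrix.of fun a i => (fderiv ℝ f y (EuclideanSpace.single a 1)) i

/-- Stein's unbiased risk estimate of the estimator `f` at the observation `y`, for noise level
`σ`: `‖f(y) - y‖² + 2σ² trace ∇f(y) - nσ²`. -/
noncomputable def sure {n : ℕ} (σ : ℝ)
    (f : EuclideanSpace ℝ (Fin n) → EuclideanSpace ℝ (Fin n)) (y : EuclideanSpace ℝ (Fin n)) : ℝ :=
  ‖f y - y‖ ^ 2 + 2 * σ ^ 2 * (gradMatrix f y).trace - n * σ ^ 2

/-- `s* = max_k E[trace((∇f_k(y) - ∇f_{j₀}(y))²)]`, where `y` is the random observation. -/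
noncomputable def sStar {n m : ℕ} {Ω : Type*} [MeasurableSpace Ω] (P : Measure Ω)
    (y : Ω → EuclideanSpace ℝ (Fin n))
    (f : Fin m → EuclideanSpace ℝ (Fin n) → EuclideanSpace ℝ (Fin n)) (j₀ : Fin m) : ℝ :=
  ⨆ k, ∫ ω, ((gradMatrix (f k) (y ω) - gradMatrix (f j₀) (y ω)) ^ 2).trace ∂P

open Filter Topology
open scoped RealInnerProductSpace

/-! Put `G j x = μhat j (μ + x) - μ`, so that the losses are `‖G j ε‖`, and let `Z_j = ⟪ε, G j ε⟫ -
σ² div G j (ε)`, which is `steinDiv`. Expanding the square, SURE of `j` equals `‖G j ε‖² - 2 Z_j`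
plus a term free of `j`. Hence minimality of `khat` says that, almost surely, `‖G khat‖² - ‖G j‖² ≤
2 (Z_khat - Z_j)` for every `j`, and by linearity the right side is twice the `steinDiv` of the
difference field. Everything rests on controlling `steinDiv g` for a Lipschitz field `g`: it has
mean zero, and the second order Stein formula `LipschitzWith.integral_steinDiv_sq` gives `E Z² = σ²
E‖g‖² + σ⁴ E tr((∇g)²)`.

For (i) and (iii), compare one field `g = G j` with `h = G j₀`. Factor `‖g‖² - ‖h‖² = (‖g‖ -
‖h‖)(‖g‖ + ‖h‖)`. If `R² = E‖g - h‖²` is small, it is enough that the squared excess is at most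
`2Z`, together with the second moment of `Z`. If `R²` is large, the trace term is dominated and `Z`
has standard deviation of order `σR`; moreover the `2L`-Lipschitz sum `‖g‖ + ‖h‖` stays, by
Poincaré, near its mean, which is at least comparable to `R`. Dividing by the sum leaves an excess
of order `σ`. This is `pair_tail` (Chebyshev) and `pair_moment` (an integrable majorant); a union
bound or a sum over `j` produces the factor `m`.

Part (ii) is Gaussian concentration of the `2L`-Lipschitz function `‖G j₀‖ - ‖G j‖`, whose mean is
nonpositive by the choice of `j₀`. Part (iv) uses `2Z ≤ Z²/c + c` summed over `j`, `E Z_j = 0`, the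
second order Stein formula, and optimisation over `c`.

The Gaussian tools all come from Stein's lemma `ExpLip.stein`. Interpolating along rotations of a
pair of independent Gaussians gives the covariance inequality `integral_mul_sub_le`, hence Poincaré
and concentration. Integrating by parts twice, with mollification to reach Lipschitz regularity,
gives the second order formula. -/

/-- The centred Gaussian measure on `ℝⁿ` with covariance matrix `v I_n`. -/
noncomputable abbrev isoGaussian (n : ℕ) (v : ℝ) : Measure (EuclideanSpace ℝ (Fin n)) :=
  multivariateGaussian 0 (v • (1 : Matrix (Fin n) (Fin n) ℝ))

/-- The density of `isoGaussian n v`. -/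
noncomputable def isoGaussianPDF (n : ℕ) (v : ℝ) (x : EuclideanSpace ℝ (Fin n)) : ℝ :=
  ((2 * Real.pi * v) ^ ((n : ℝ) / 2))⁻¹ * Real.exp (-‖x‖ ^ 2 / (2 * v))

/-! ### Density, integrability and translation of the isotropic Gaussian -/

section Density

variable {n : ℕ} {v : ℝ}

lemma isoGaussianPDF_nonneg (hv : 0 < v) (x : EuclideanSpace ℝ (Fin n)) :
    0 ≤ isoGaussianPDF n v x := by
  unfold isoGaussianPDF; positivity

lemma continuous_isoGaussianPDF : Continuous (isoGaussianPDF n v) := by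
  unfold isoGaussianPDF; fun_prop

lemma integrable_exp_neg_mul_sq_norm {b : ℝ} (hb : 0 < b) :
    Integrable (fun x : EuclideanSpace ℝ (Fin n) => Real.exp (-b * ‖x‖ ^ 2)) := by
  have h := (GaussianFourier.integrable_cexp_neg_mul_sq_norm_add
    (V := EuclideanSpace ℝ (Fin n)) (b := (b : ℂ)) (by simpa using hb) 0 0).norm
  refine h.congr (Eventually.of_forall fun x => ?_)
  simp [Complex.norm_exp, ← Complex.ofReal_pow]

lemma integral_withDensity_isoGaussianPDF {F : Type*} [NormedAddCommGroup F] [NormedSpace ℝ F]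
    (hv : 0 < v) (f : EuclideanSpace ℝ (Fin n) → F) :
    ∫ x, f x ∂(volume.withDensity fun x => ENNReal.ofReal (isoGaussianPDF n v x)) =
      ∫ x, isoGaussianPDF n v x • f x := by
  rw [integral_withDensity_eq_integral_toReal_smul (by
    exact continuous_isoGaussianPDF.measurable.ennreal_ofReal) (by simp)]
  simp [ENNReal.toReal_ofReal, isoGaussianPDF_nonneg hv]

lemma integrable_isoGaussianPDF (hv : 0 < v) :
    Integrable (isoGaussianPDF n v) := by
  have := (integrable_exp_neg_mul_sq_norm (n := n) (b := (2 * v)⁻¹) (by positivity)).const_mul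
    (((2 * Real.pi * v) ^ ((n : ℝ) / 2))⁻¹)
  refine this.congr (Eventually.of_forall fun x => ?_)
  simp only [isoGaussianPDF]
  congr 2
  field_simp

lemma isoGaussian_eq_withDensity (hv : 0 < v) :
    isoGaussian n v = volume.withDensity fun x => ENNReal.ofReal (isoGaussianPDF n v x) := by
  have : IsFiniteMeasure
      ((volume : Measure (EuclideanSpace ℝ (Fin n))).withDensity
        fun x => ENNReal.ofReal (isoGaussianPDF n v x)) :=
    isFiniteMeasure_withDensity_ofReal (integrable_isoGaussianPDF hv).2
  apply Measure.ext_of_charFun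
  ext t
  rw [charFun_multivariateGaussian (Matrix.PosSemidef.one.smul hv.le), charFun_apply,
    integral_withDensity_isoGaussianPDF hv]
  have h1 := GaussianFourier.integral_cexp_neg_mul_sq_norm_add
    (V := EuclideanSpace ℝ (Fin n)) (b := ((2 * v)⁻¹ : ℝ))
    (by rw [Complex.ofReal_re]; positivity) Complex.I t
  have h2 : ∀ x : EuclideanSpace ℝ (Fin n),
      isoGaussianPDF n v x • Complex.exp (⟪x, t⟫ * Complex.I) =
      (((2 * Real.pi * v) ^ ((n : ℝ) / 2))⁻¹ : ℝ) *
        Complex.exp (-((2 * v)⁻¹ : ℝ) * (‖x‖ : ℂ) ^ 2 + Complex.I * ⟪t, x⟫) := by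
    intro x
    rw [Complex.exp_add, real_inner_comm, isoGaussianPDF, Complex.real_smul]
    push_cast
    rw [mul_assoc, mul_comm Complex.I]
    congr 3
    field_simp
  simp_rw [h2]
  rw [integral_const_mul, h1]
  have h3 : ((Real.pi : ℂ) / ((2 * v)⁻¹ : ℝ)) ^
      ((Module.finrank ℝ (EuclideanSpace ℝ (Fin n)) : ℂ) / 2) =
      (((2 * Real.pi * v) ^ ((n : ℝ) / 2) : ℝ) : ℂ) := by
    rw [Complex.ofReal_cpow (by positivity)]
    simp only [finrank_euclideanSpace, Fintype.card_fin]
    push_cast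
    congr 1
    field_simp
  rw [h3, ← mul_assoc, ← Complex.ofReal_mul, inv_mul_cancel₀ (by positivity), Complex.ofReal_one,
    one_mul]
  congr 1
  have h4 : t.ofLp ⬝ᵥ (v • (1 : Matrix (Fin n) (Fin n) ℝ)).mulVec t.ofLp = v * ‖t‖ ^ 2 := by
    rw [Matrix.smul_mulVec, Matrix.one_mulVec, dotProduct_smul, EuclideanSpace.real_norm_sq_eq]
    simp [dotProduct, pow_two]
  rw [h4]
  have : (v : ℂ) ≠ 0 := by exact_mod_cast hv.ne'
  simp
  field_simp
  norm_num

lemma integral_isoGaussian {F : Type*} [NormedAddCommGroup F] [NormedSpace ℝ F]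
    (hv : 0 < v) (f : EuclideanSpace ℝ (Fin n) → F) :
    ∫ x, f x ∂isoGaussian n v = ∫ x, isoGaussianPDF n v x • f x := by
  rw [isoGaussian_eq_withDensity hv, integral_withDensity_isoGaussianPDF hv]

lemma isoGaussian_absolutelyContinuous (hv : 0 < v) : isoGaussian n v ≪ volume := by
  rw [isoGaussian_eq_withDensity hv]
  exact withDensity_absolutelyContinuous _ _

/-- Half of the Gaussian exponent absorbs the linear term: `c r - r²/(2v) ≤ c² v - r²/(4v)`, the gap
being a square. -/
lemma integrable_exp_mul_norm_isoGaussian (hv : 0 < v) (c : ℝ) :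
    Integrable (fun x => Real.exp (c * ‖x‖)) (isoGaussian n v) := by
  rw [isoGaussian_eq_withDensity hv, integrable_withDensity_iff_integrable_smul'
    continuous_isoGaussianPDF.measurable.ennreal_ofReal (by simp)]
  have := (integrable_exp_neg_mul_sq_norm (n := n) (b := (4 * v)⁻¹) (by positivity)).const_mul
    (((2 * Real.pi * v) ^ ((n : ℝ) / 2))⁻¹ * Real.exp (c ^ 2 * v))
  refine this.mono' (by
    apply Continuous.aestronglyMeasurable
    simp_rw [ENNReal.toReal_ofReal (isoGaussianPDF_nonneg hv _)]
    have := continuous_isoGaussianPDF (n := n) (v := v)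
    fun_prop) (Eventually.of_forall fun x => ?_)
  rw [ENNReal.toReal_ofReal (isoGaussianPDF_nonneg hv _), smul_eq_mul, Real.norm_eq_abs,
    abs_of_nonneg (mul_nonneg (isoGaussianPDF_nonneg hv _) (Real.exp_nonneg _)), isoGaussianPDF,
    mul_assoc, mul_assoc _ _ (Real.exp (-(4 * v)⁻¹ * _)), ← Real.exp_add, ← Real.exp_add]
  refine mul_le_mul_of_nonneg_left (Real.exp_le_exp.2 ?_) (by positivity)
  rw [← sub_nonneg]
  have : c ^ 2 * v + -(4 * v)⁻¹ * ‖x‖ ^ 2 - (-‖x‖ ^ 2 / (2 * v) + c * ‖x‖) =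
      (2 * v * c - ‖x‖) ^ 2 / (4 * v) := by
    field_simp; ring
  rw [this]; positivity

/-- The Cameron–Martin density. It lets a translation be differentiated without differentiating `f`,
which is one half of Stein's lemma. -/
lemma integral_comp_add_isoGaussian (hv : 0 < v) (f : EuclideanSpace ℝ (Fin n) → ℝ)
    (a : EuclideanSpace ℝ (Fin n)) :
    ∫ x, f (x + a) ∂isoGaussian n v =
      ∫ x, Real.exp ((⟪a, x⟫ - ‖a‖ ^ 2 / 2) / v) * f x ∂isoGaussian n v := by
  rw [integral_isoGaussian hv, integral_isoGaussian hv,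
    ← integral_add_right_eq_self (fun x => isoGaussianPDF n v x •
      (Real.exp ((⟪a, x⟫ - ‖a‖ ^ 2 / 2) / v) * f x)) a]
  congr 1 with x
  simp only [smul_eq_mul, isoGaussianPDF]
  rw [← mul_assoc, mul_assoc _ (Real.exp _) (Real.exp _), ← Real.exp_add]
  congr 3
  rw [norm_add_sq_real, inner_add_right, real_inner_self_eq_norm_sq, real_inner_comm]
  field_simp
  ring

lemma map_rotation_isoGaussian (θ : ℝ) :
    ((isoGaussian n v).prod (isoGaussian n v)).map (ContinuousLinearMap.rotation θ) =
      (isoGaussian n v).prod (isoGaussian n v) :=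
  IsGaussian.map_rotation_eq_self (by simp) θ

end Density

/-! ### An algebra of test functions of exponential growth -/

section ExpLip

variable {E : Type*} [NormedAddCommGroup E] {f g : E → ℝ}

/-- Functions of at most exponential growth, which are locally Lipschitz with a constant of at most
exponential growth. -/
def ExpLip (f : E → ℝ) : Prop :=
  ∃ K : ℝ, 0 ≤ K ∧ (∀ x, |f x| ≤ K * Real.exp (K * ‖x‖)) ∧
    ∀ x z, ‖z‖ ≤ 1 → |f (x + z) - f x| ≤ K * Real.exp (K * ‖x‖) * ‖z‖

lemma mul_exp_mul_mono {a b r : ℝ} (ha : 0 ≤ a) (hab : a ≤ b) (hr : 0 ≤ r) :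
    a * Real.exp (a * r) ≤ b * Real.exp (b * r) := by
  gcongr
  exact ha.trans hab

lemma expLip_of_bound {A B C D : ℝ} (hA : ∀ x, |f x| ≤ A * Real.exp (B * ‖x‖))
    (hC : ∀ x z, ‖z‖ ≤ 1 → |f (x + z) - f x| ≤ C * Real.exp (D * ‖x‖) * ‖z‖) : ExpLip f := by
  have h : ∀ a b : ℝ, a ≤ |A| + |B| + |C| + |D| → b ≤ |A| + |B| + |C| + |D| → ∀ x : E,
      a * Real.exp (b * ‖x‖) ≤
        (|A| + |B| + |C| + |D|) * Real.exp ((|A| + |B| + |C| + |D|) * ‖x‖) := by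
    intro a b ha hb x
    have : Real.exp (b * ‖x‖) ≤ Real.exp ((|A| + |B| + |C| + |D|) * ‖x‖) := by gcongr
    exact mul_le_mul ha this (by positivity) (by positivity)
  have h1 := le_abs_self A
  have h2 := le_abs_self B
  have h3 := le_abs_self C
  have h4 := le_abs_self D
  have h5 := abs_nonneg A
  have h6 := abs_nonneg B
  have h7 := abs_nonneg C
  have h8 := abs_nonneg D
  refine ⟨|A| + |B| + |C| + |D|, by positivity, fun x => (hA x).trans (h _ _ ?_ ?_ x),
    fun x z hz => (hC x z hz).trans (mul_le_mul_of_nonneg_right (h _ _ ?_ ?_ x) (norm_nonneg _))⟩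
  all_goals linarith

lemma ExpLip.exists_common (hf : ExpLip f) (hg : ExpLip g) : ∃ K : ℝ, 0 ≤ K ∧
    (∀ x, |f x| ≤ K * Real.exp (K * ‖x‖)) ∧
    (∀ x z, ‖z‖ ≤ 1 → |f (x + z) - f x| ≤ K * Real.exp (K * ‖x‖) * ‖z‖) ∧
    (∀ x, |g x| ≤ K * Real.exp (K * ‖x‖)) ∧
    ∀ x z, ‖z‖ ≤ 1 → |g (x + z) - g x| ≤ K * Real.exp (K * ‖x‖) * ‖z‖ := by
  obtain ⟨a, ha, h1, h2⟩ := hf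
  obtain ⟨b, hb, h3, h4⟩ := hg
  refine ⟨max a b, le_max_of_le_left ha, fun x => (h1 x).trans ?_, fun x z hz =>
    (h2 x z hz).trans ?_, fun x => (h3 x).trans ?_, fun x z hz => (h4 x z hz).trans ?_⟩
  · exact mul_exp_mul_mono ha (le_max_left _ _) (norm_nonneg _)
  · exact mul_le_mul_of_nonneg_right (mul_exp_mul_mono ha (le_max_left _ _) (norm_nonneg _))
      (norm_nonneg _)
  · exact mul_exp_mul_mono hb (le_max_right _ _) (norm_nonneg _)
  · exact mul_le_mul_of_nonneg_right (mul_exp_mul_mono hb (le_max_right _ _) (norm_nonneg _))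
      (norm_nonneg _)

lemma ExpLip.add (hf : ExpLip f) (hg : ExpLip g) : ExpLip fun x => f x + g x := by
  obtain ⟨K, hK, h1, h2, h3, h4⟩ := hf.exists_common hg
  refine expLip_of_bound (A := 2 * K) (B := K) (C := 2 * K) (D := K) (fun x => ?_) fun x z hz => ?_
  · linarith [abs_add_le (f x) (g x), h1 x, h3 x]
  · have := abs_add_le (f (x + z) - f x) (g (x + z) - g x)
    rw [show f (x + z) + g (x + z) - (f x + g x) = f (x + z) - f x + (g (x + z) - g x) by ring]
    linarith [h2 x z hz, h4 x z hz]

lemma ExpLip.mul (hf : ExpLip f) (hg : ExpLip g) : ExpLip fun x => f x * g x := by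
  obtain ⟨K, hK, h1, h2, h3, h4⟩ := hf.exists_common hg
  have e2 : ∀ x : E, K * Real.exp (K * ‖x‖) * (K * Real.exp (K * ‖x‖)) =
      K ^ 2 * Real.exp (2 * K * ‖x‖) := by
    intro x
    rw [show 2 * K * ‖x‖ = K * ‖x‖ + K * ‖x‖ by ring, Real.exp_add]; ring
  refine expLip_of_bound (A := K ^ 2) (B := 2 * K) (C := K ^ 2 * (Real.exp K + 1)) (D := 2 * K)
    (fun x => ?_) fun x z hz => ?_
  · rw [abs_mul, ← e2]
    exact mul_le_mul (h1 x) (h3 x) (abs_nonneg _) (by positivity)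
  -- Moving the base point by at most one unit costs a factor `exp K`.
  · have h5 : |f (x + z)| ≤ Real.exp K * (K * Real.exp (K * ‖x‖)) := by
      refine (h1 _).trans ?_
      rw [← mul_assoc, mul_comm (Real.exp K), mul_assoc, ← Real.exp_add]
      have : K * ‖x + z‖ ≤ K + K * ‖x‖ := by
        nlinarith [norm_add_le x z]
      gcongr
    have h6 : f (x + z) * g (x + z) - f x * g x =
        f (x + z) * (g (x + z) - g x) + (f (x + z) - f x) * g x := by ring
    rw [h6]
    refine (abs_add_le _ _).trans ?_
    rw [abs_mul, abs_mul]
    calc _ ≤ Real.exp K * (K * Real.exp (K * ‖x‖)) * (K * Real.exp (K * ‖x‖) * ‖z‖) +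
          K * Real.exp (K * ‖x‖) * ‖z‖ * (K * Real.exp (K * ‖x‖)) := by
          gcongr
          exacts [h4 x z hz, h2 x z hz, h3 x]
      _ = (Real.exp K + 1) * (K * Real.exp (K * ‖x‖) * (K * Real.exp (K * ‖x‖))) * ‖z‖ := by ring
      _ = _ := by rw [e2]; ring

lemma LipschitzWith.expLip {L : ℝ≥0} (hf : LipschitzWith L f) : ExpLip f := by
  refine expLip_of_bound (A := |f 0| + L) (B := 1) (C := L) (D := 0) (fun x => ?_) fun x z hz => ?_
  · have h1 := hf.norm_sub_le x 0
    rw [sub_zero, Real.norm_eq_abs] at h1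
    have h2 := abs_sub_abs_le_abs_sub (f x) (f 0)
    have h3 := Real.add_one_le_exp (1 * ‖x‖)
    have h4 := abs_nonneg (f 0)
    have h5 := L.2
    have h6 := norm_nonneg x
    have : (1 : ℝ) ≤ Real.exp (1 * ‖x‖) := by linarith
    have : L * ‖x‖ ≤ L * Real.exp (1 * ‖x‖) := by gcongr; linarith
    nlinarith
  · simpa [Real.norm_eq_abs] using hf.norm_sub_le (x + z) x

lemma expLip_const (c : ℝ) : ExpLip fun _ : E => c :=
  (LipschitzWith.const c).expLip

lemma ExpLip.const_mul (hf : ExpLip f) (c : ℝ) : ExpLip fun x => c * f x :=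
  (expLip_const c).mul hf

lemma ExpLip.neg (hf : ExpLip f) : ExpLip fun x => -f x := by
  simpa using hf.const_mul (-1)

lemma ExpLip.sub (hf : ExpLip f) (hg : ExpLip g) : ExpLip fun x => f x - g x := by
  simpa [sub_eq_add_neg] using hf.add hg.neg

/-- These exponentials are the reason the class allows exponential rather than polynomial growth:
they are the test functions in the bound on the moment generating function. -/
lemma LipschitzWith.expLip_exp {L : ℝ≥0} (hf : LipschitzWith L f) (c : ℝ) :
    ExpLip fun x => Real.exp (c * f x) := by
  have key : ∀ x : E, Real.exp (c * f x) ≤ Real.exp (|c| * |f 0|) * Real.exp (|c| * L * ‖x‖) := by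
    intro x
    rw [← Real.exp_add]
    refine Real.exp_le_exp.2 ?_
    have h1 := hf.norm_sub_le x 0
    rw [sub_zero, Real.norm_eq_abs] at h1
    have h2 := abs_sub_abs_le_abs_sub (f x) (f 0)
    calc c * f x ≤ |c| * |f x| := by rw [← abs_mul]; exact le_abs_self _
      _ ≤ |c| * (|f 0| + L * ‖x‖) := by gcongr; linarith
      _ = _ := by ring
  refine expLip_of_bound (A := Real.exp (|c| * |f 0|)) (B := |c| * L)
    (C := |c| * L * Real.exp (|c| * L) * Real.exp (|c| * |f 0|)) (D := |c| * L) (fun x => ?_)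
    fun x z hz => ?_
  · rw [abs_of_pos (Real.exp_pos _)]; exact key x
  · have h1 : |c * f (x + z) - c * f x| ≤ |c| * L * ‖z‖ := by
      rw [← mul_sub, abs_mul, mul_assoc]
      gcongr
      simpa [Real.norm_eq_abs] using hf.norm_sub_le (x + z) x
    have hexp : ∀ t : ℝ, |Real.exp t - 1| ≤ |t| * Real.exp |t| := by
      intro t
      rcases le_total 0 t with ht | ht
      · rw [abs_of_nonneg (by linarith [Real.add_one_le_exp t]), abs_of_nonneg ht]
        have := Real.add_one_le_exp (-t)
        have h := Real.exp_pos t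
        have : Real.exp t * Real.exp (-t) = 1 := by rw [← Real.exp_add]; simp
        nlinarith
      · rw [abs_of_nonpos (by linarith [Real.exp_le_one_iff.2 ht]), abs_of_nonpos ht]
        have := Real.add_one_le_exp t
        have := Real.one_le_exp (neg_nonneg.2 ht)
        nlinarith
    have h2 : Real.exp (c * f (x + z)) - Real.exp (c * f x) =
        Real.exp (c * f x) * (Real.exp (c * f (x + z) - c * f x) - 1) := by
      rw [mul_sub, ← Real.exp_add]; ring_nf
    rw [h2, abs_mul, abs_of_pos (Real.exp_pos _)]
    calc _ ≤ Real.exp (|c| * |f 0|) * Real.exp (|c| * L * ‖x‖) *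
          ((|c| * L * ‖z‖) * Real.exp (|c| * L)) := by
          gcongr
          · exact key x
          · refine (hexp _).trans ?_
            gcongr
            exact h1.trans (mul_le_of_le_one_right (by positivity) hz)
      _ = _ := by ring

lemma ExpLip.continuous (hf : ExpLip f) : Continuous f := by
  obtain ⟨K, hK, -, h2⟩ := hf
  rw [continuous_iff_continuousAt]
  intro x
  rw [ContinuousAt, tendsto_iff_norm_sub_tendsto_zero]
  have h3 : Tendsto (fun y => K * Real.exp (K * ‖x‖) * ‖y - x‖) (𝓝 x) (𝓝 0) := by
    have : Continuous fun y => K * Real.exp (K * ‖x‖) * ‖y - x‖ := by fun_prop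
    simpa using this.tendsto x
  refine squeeze_zero' (Eventually.of_forall fun _ => norm_nonneg _) ?_ h3
  filter_upwards [Metric.closedBall_mem_nhds x one_pos] with y hy
  have := h2 x (y - x) (by simpa [dist_eq_norm] using hy)
  simpa [Real.norm_eq_abs] using this

variable [NormedSpace ℝ E]

lemma ContinuousLinearMap.expLip (l : E →L[ℝ] ℝ) : ExpLip fun x => l x :=
  l.lipschitz.expLip

/-- The restriction `|s| ≤ 1` keeps increments of norm at most one within the range where `ExpLip`
controls them. -/
lemma ExpLip.comp_affine (hf : ExpLip f) (u : E) (s : ℝ) (hs : |s| ≤ 1) :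
    ExpLip fun x => f (u + s • x) := by
  obtain ⟨K, hK, h1, h2⟩ := hf
  have key : ∀ x : E, K * Real.exp (K * ‖u + s • x‖) ≤ K * Real.exp (K * ‖u‖) * Real.exp (K * ‖x‖) := by
    intro x
    rw [mul_assoc, ← Real.exp_add, ← mul_add]
    gcongr
    refine (norm_add_le _ _).trans ?_
    rw [norm_smul, Real.norm_eq_abs]
    nlinarith [norm_nonneg x]
  refine expLip_of_bound (A := K * Real.exp (K * ‖u‖)) (B := K) (C := K * Real.exp (K * ‖u‖))
    (D := K) (fun x => (h1 _).trans (key x)) fun x z hz => ?_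
  have hsz : ‖s • z‖ ≤ ‖z‖ := by
    rw [norm_smul, Real.norm_eq_abs]; nlinarith [norm_nonneg z]
  rw [smul_add, ← add_assoc]
  refine (h2 _ _ (hsz.trans hz)).trans ?_
  have := key x
  gcongr

lemma ExpLip.norm_fderiv_le (hf : ExpLip f) :
    ∃ K : ℝ, 0 ≤ K ∧ ∀ x, ‖fderiv ℝ f x‖ ≤ K * Real.exp (K * ‖x‖) := by
  obtain ⟨K, hK, -, h2⟩ := hf
  refine ⟨K, hK, fun x => norm_fderiv_le_of_lip' ℝ (by positivity) ?_⟩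
  filter_upwards [Metric.closedBall_mem_nhds x one_pos] with y hy
  have := h2 x (y - x) (by simpa [dist_eq_norm] using hy)
  simpa [Real.norm_eq_abs] using this

/-- Rademacher's theorem on countably many balls of radius `1/2`: two points of such a ball are at
distance at most one, so the local increment bound makes `f` Lipschitz there. -/
lemma ExpLip.ae_differentiableAt [FiniteDimensional ℝ E] [MeasurableSpace E] [BorelSpace E]
    {μ : Measure E} [μ.IsAddHaarMeasure] (hf : ExpLip f) : ∀ᵐ x ∂μ, DifferentiableAt ℝ f x := by
  obtain ⟨K, hK, -, h2⟩ := hf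
  obtain ⟨S, hS, hSU⟩ := TopologicalSpace.exists_countable_dense E
  have key : ∀ x₀ : E, ∀ᵐ x ∂μ, x ∈ Metric.ball x₀ (1 / 2) → DifferentiableAt ℝ f x := by
    intro x₀
    have hl : LipschitzOnWith (Real.toNNReal (K * Real.exp (K * (‖x₀‖ + 1 / 2)))) f
        (Metric.ball x₀ (1 / 2)) := by
      refine LipschitzOnWith.of_dist_le_mul fun x hx y hy => ?_
      rw [Real.coe_toNNReal _ (by positivity), Real.dist_eq, dist_eq_norm]
      have hxy : ‖x - y‖ ≤ 1 := by
        rw [← dist_eq_norm]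
        linarith [dist_triangle_right x y x₀, Metric.mem_ball.1 hx, Metric.mem_ball.1 hy]
      have := h2 y (x - y) hxy
      rw [add_sub_cancel] at this
      refine this.trans ?_
      have hy' : ‖y‖ ≤ ‖x₀‖ + 1 / 2 := by
        have h := Metric.mem_ball.1 hy
        rw [dist_eq_norm] at h
        linarith [norm_le_norm_add_norm_sub' y x₀]
      gcongr
    filter_upwards [hl.ae_differentiableWithinAt_of_mem (μ := μ)] with x hx hxb
    exact (hx hxb).differentiableAt (Metric.isOpen_ball.mem_nhds hxb)
  have : ∀ᵐ x ∂μ, ∀ x₀ ∈ S, x ∈ Metric.ball x₀ (1 / 2) → DifferentiableAt ℝ f x :=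
    (ae_ball_iff hS).2 fun x₀ _ => key x₀
  filter_upwards [this] with x hx
  obtain ⟨x₀, hx₀, h⟩ := hSU.exists_dist_lt x (ε := 1 / 2) (by norm_num)
  exact hx x₀ hx₀ (by simpa using h)

end ExpLip

/-! ### Stein's lemma -/

section Stein

variable {n : ℕ} {v : ℝ} {f : EuclideanSpace ℝ (Fin n) → ℝ}

lemma ExpLip.integrable (hv : 0 < v) (hf : ExpLip f) : Integrable f (isoGaussian n v) := by
  have hc := hf.continuous
  obtain ⟨K, hK, h1, -⟩ := hf
  exact ((integrable_exp_mul_norm_isoGaussian hv K).const_mul K).mono' hc.aestronglyMeasurable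
    (Eventually.of_forall h1)

lemma ExpLip.ae_differentiableAt_isoGaussian (hv : 0 < v) (hf : ExpLip f) :
    ∀ᵐ x ∂isoGaussian n v, DifferentiableAt ℝ f x :=
  (isoGaussian_absolutelyContinuous hv).ae_le hf.ae_differentiableAt

/-- Functions with at most exponential growth are integrable with respect to a Gaussian measure. -/
lemma integrable_of_exp_bound {F : Type*} [NormedAddCommGroup F] (hv : 0 < v)
    {g : EuclideanSpace ℝ (Fin n) → F} (hg : AEStronglyMeasurable g (isoGaussian n v)) {A B : ℝ}
    (h : ∀ x, ‖g x‖ ≤ A * Real.exp (B * ‖x‖)) : Integrable g (isoGaussian n v) :=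
  ((integrable_exp_mul_norm_isoGaussian hv B).const_mul A).mono' hg (Eventually.of_forall h)

lemma ExpLip.integrable_fderiv (hv : 0 < v) (hf : ExpLip f) :
    Integrable (fun x => fderiv ℝ f x) (isoGaussian n v) := by
  obtain ⟨K, hK, h⟩ := hf.norm_fderiv_le
  exact integrable_of_exp_bound hv (measurable_fderiv ℝ f).aestronglyMeasurable h

/-- Gaussian integration by parts (Stein's lemma). -/
theorem ExpLip.stein (hv : 0 < v) (hf : ExpLip f) (a : EuclideanSpace ℝ (Fin n)) :
    ∫ x, ⟪a, x⟫ * f x ∂isoGaussian n v = v * ∫ x, fderiv ℝ f x a ∂isoGaussian n v := by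
  -- Both sides are homogeneous in `a`, while increments are controlled only up to norm one.
  wlog ha : ‖a‖ ≤ 1 generalizing a
  · push Not at ha
    have hp : 0 < ‖a‖ := one_pos.trans ha
    have := this (‖a‖⁻¹ • a) (by rw [norm_smul, norm_inv, norm_norm, inv_mul_cancel₀ hp.ne'])
    simp only [real_inner_smul_left, map_smul, smul_eq_mul, mul_assoc, integral_const_mul] at this
    have h := congrArg (fun r => ‖a‖ * r) this
    beta_reduce at h
    rw [← mul_assoc, mul_inv_cancel₀ hp.ne', one_mul] at h
    rw [h]
    field_simp
  have hcf := hf.continuous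
  have hint := hf.integrable hv
  have hdiff := hf.ae_differentiableAt_isoGaussian hv
  have hmul : ExpLip fun x : EuclideanSpace ℝ (Fin n) => ⟪a, x⟫ * f x :=
    (ContinuousLinearMap.expLip (innerSL ℝ a)).mul hf
  obtain ⟨K, hK, h1, h2⟩ := hf
  -- The derivative at `0` of `t ↦ E f(x + t a)` is computed twice. Here it passes onto `f`, which
  -- is differentiable almost everywhere.
  have hd1 : HasDerivAt (fun t : ℝ => ∫ x, f (x + t • a) ∂isoGaussian n v)
      (∫ x, fderiv ℝ f x a ∂isoGaussian n v) 0 := by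
    refine (hasDerivAt_integral_of_dominated_loc_of_lip (s := Metric.ball (0 : ℝ) (1 / 2))
      (bound := fun x => K * (Real.exp K * Real.exp (K * ‖x‖))) (Metric.ball_mem_nhds _ (by norm_num))
      (Eventually.of_forall fun t => Continuous.aestronglyMeasurable (by fun_prop))
      (by simpa using hint) (measurable_fderiv_apply_const ℝ f a).aestronglyMeasurable
      (Eventually.of_forall fun x => ?_)
      (((integrable_exp_mul_norm_isoGaussian hv K).const_mul _).const_mul _) ?_).2
    · refine LipschitzOnWith.of_dist_le_mul fun s hs t ht => ?_
      rw [Real.coe_nnabs, abs_of_nonneg (by positivity), Real.dist_eq, Real.dist_eq]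
      have hst : |s - t| ≤ 1 := by
        rw [← Real.dist_eq]
        linarith [dist_triangle_right s t 0, Metric.mem_ball.1 hs, Metric.mem_ball.1 ht]
      have hsta : ‖(s - t) • a‖ ≤ |s - t| := by
        rw [norm_smul, Real.norm_eq_abs]; nlinarith [abs_nonneg (s - t)]
      have := h2 (x + t • a) ((s - t) • a) (hsta.trans hst)
      rw [add_assoc, ← add_smul, add_sub_cancel] at this
      refine this.trans ?_
      rw [← Real.exp_add, ← mul_one_add, add_comm 1]
      have h3 : ‖x + t • a‖ ≤ ‖x‖ + 1 := by
        refine (norm_add_le _ _).trans ?_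
        rw [norm_smul, Real.norm_eq_abs]
        have : |t| ≤ 1 := by
          have := Metric.mem_ball.1 ht
          rw [Real.dist_eq, sub_zero] at this; linarith
        nlinarith [norm_nonneg a]
      gcongr
    · filter_upwards [hdiff] with x hx
      have h := hx.hasFDerivAt
      have h' : HasDerivAt (fun t : ℝ => x + t • a) a 0 := by
        simpa using ((hasDerivAt_id (0 : ℝ)).smul_const a).const_add x
      exact HasFDerivAt.comp_hasDerivAt 0 (by simpa using h) h'
  -- Here the shift is moved to the Gaussian density, and only the explicit exponential is
  -- differentiated.
  have hd2 : HasDerivAt (fun t : ℝ => ∫ x, f (x + t • a) ∂isoGaussian n v)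
      (∫ x, (⟪a, x⟫ / v) * f x ∂isoGaussian n v) 0 := by
    simp_rw [integral_comp_add_isoGaussian hv]
    have hbound : ∀ t ∈ Metric.ball (0 : ℝ) 1, ∀ x : EuclideanSpace ℝ (Fin n),
        ‖Real.exp ((⟪t • a, x⟫ - ‖t • a‖ ^ 2 / 2) / v) * ((⟪a, x⟫ - t * ‖a‖ ^ 2) / v) * f x‖ ≤
          (K / v) * Real.exp ((v⁻¹ + 1 + K) * ‖x‖) := by
      intro t ht x
      have ht1 : |t| ≤ 1 := by
        have := Metric.mem_ball.1 ht
        rw [Real.dist_eq, sub_zero] at this; exact this.le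
      have hax : |⟪a, x⟫| ≤ ‖x‖ := (abs_real_inner_le_norm a x).trans
        (mul_le_of_le_one_left (norm_nonneg _) ha)
      rw [norm_mul, norm_mul, Real.norm_eq_abs, Real.norm_eq_abs, Real.norm_eq_abs,
        abs_of_pos (Real.exp_pos _)]
      have e1 : Real.exp ((⟪t • a, x⟫ - ‖t • a‖ ^ 2 / 2) / v) ≤ Real.exp (v⁻¹ * ‖x‖) := by
        refine Real.exp_le_exp.2 ?_
        rw [div_eq_inv_mul]
        refine mul_le_mul_of_nonneg_left ?_ (by positivity)
        rw [inner_smul_left, conj_trivial]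
        have : t * ⟪a, x⟫ ≤ |t| * |⟪a, x⟫| := by rw [← abs_mul]; exact le_abs_self _
        nlinarith [abs_nonneg ⟪a, x⟫, sq_nonneg ‖t • a‖]
      have e2 : |(⟪a, x⟫ - t * ‖a‖ ^ 2) / v| ≤ v⁻¹ * Real.exp (1 * ‖x‖) := by
        rw [abs_div, abs_of_pos hv, div_eq_inv_mul]
        refine mul_le_mul_of_nonneg_left ?_ (by positivity)
        have := abs_sub ⟪a, x⟫ (t * ‖a‖ ^ 2)
        rw [abs_mul, abs_of_nonneg (sq_nonneg ‖a‖)] at this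
        have h3 := Real.add_one_le_exp (1 * ‖x‖)
        have : |t| * ‖a‖ ^ 2 ≤ 1 := by
          have : ‖a‖ ^ 2 ≤ 1 := by nlinarith [norm_nonneg a]
          nlinarith [abs_nonneg t, sq_nonneg ‖a‖]
        linarith
      calc _ ≤ Real.exp (v⁻¹ * ‖x‖) * (v⁻¹ * Real.exp (1 * ‖x‖)) * (K * Real.exp (K * ‖x‖)) := by
            gcongr
            exact h1 x
        _ = _ := by rw [add_mul, add_mul, Real.exp_add, Real.exp_add]; field_simp
    have := (hasDerivAt_integral_of_dominated_loc_of_deriv_le (μ := isoGaussian n v) (x₀ := (0 : ℝ))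
      (F := fun t x => Real.exp ((⟪t • a, x⟫ - ‖t • a‖ ^ 2 / 2) / v) * f x)
      (F' := fun t x => Real.exp ((⟪t • a, x⟫ - ‖t • a‖ ^ 2 / 2) / v) *
        ((⟪a, x⟫ - t * ‖a‖ ^ 2) / v) * f x)
      (bound := fun x => (K / v) * Real.exp ((v⁻¹ + 1 + K) * ‖x‖))
      (Metric.ball_mem_nhds _ one_pos)
      (Eventually.of_forall fun t => Continuous.aestronglyMeasurable (by fun_prop))
      (by simpa using hint) (Continuous.aestronglyMeasurable (by fun_prop))
      (Eventually.of_forall fun x t ht => hbound t ht x)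
      ((integrable_exp_mul_norm_isoGaussian hv _).const_mul _)
      (Eventually.of_forall fun x t _ => ?_)).2
    · simpa using this
    · refine HasDerivAt.mul_const (HasDerivAt.exp (HasDerivAt.div_const ?_ v)) (f x)
      have e : (fun t : ℝ => ⟪t • a, x⟫ - ‖t • a‖ ^ 2 / 2) =
          fun t => t * ⟪a, x⟫ - t ^ 2 * (‖a‖ ^ 2 / 2) := by
        ext t
        rw [inner_smul_left, conj_trivial, norm_smul, mul_pow, Real.norm_eq_abs, sq_abs]
        ring
      rw [e]
      convert! ((hasDerivAt_id t).mul_const ⟪a, x⟫).sub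
        (((hasDerivAt_id t).pow 2).mul_const (‖a‖ ^ 2 / 2)) using 1
      simp
      ring
  have := hd1.unique hd2
  rw [this, ← integral_const_mul]
  congr 1 with x
  field_simp

end Stein

/-! ### Covariance inequality, Poincaré inequality and concentration -/

section Covariance

variable {n : ℕ} {v : ℝ} {Λ : ℝ≥0} {φ ψ : EuclideanSpace ℝ (Fin n) → ℝ}

lemma measurePreserving_rotation (θ : ℝ) :
    MeasurePreserving (ContinuousLinearMap.rotation θ)
      ((isoGaussian n v).prod (isoGaussian n v)) ((isoGaussian n v).prod (isoGaussian n v)) :=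
  ⟨by fun_prop, map_rotation_isoGaussian θ⟩

lemma measurePreserving_cos_smul_add_sin_smul (θ : ℝ) :
    MeasurePreserving (fun p : EuclideanSpace ℝ (Fin n) × EuclideanSpace ℝ (Fin n) =>
      Real.cos θ • p.1 + Real.sin θ • p.2)
      ((isoGaussian n v).prod (isoGaussian n v)) (isoGaussian n v) :=
  measurePreserving_fst.comp (measurePreserving_rotation θ)

lemma integrable_interpolation_bound (hv : 0 < v) (hψ : ExpLip ψ) (Λ : ℝ) :
    Integrable (fun p : EuclideanSpace ℝ (Fin n) × EuclideanSpace ℝ (Fin n) =>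
      Λ * (Real.exp (1 * ‖p.1‖) * |ψ p.1|) * Real.exp (1 * ‖p.2‖))
      ((isoGaussian n v).prod (isoGaussian n v)) := by
  have hc := hψ.continuous
  obtain ⟨K, hK, h, -⟩ := hψ
  refine Integrable.mul_prod (f := fun x => Λ * (Real.exp (1 * ‖x‖) * |ψ x|))
    (Integrable.const_mul ?_ _) (integrable_exp_mul_norm_isoGaussian hv 1)
  refine integrable_of_exp_bound hv (Continuous.aestronglyMeasurable (by fun_prop)) (A := K)
    (B := 1 + K) fun x => ?_
  rw [norm_mul, Real.norm_eq_abs, Real.norm_eq_abs, abs_abs, abs_of_pos (Real.exp_pos _), add_mul,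
    Real.exp_add, mul_left_comm]
  gcongr
  exact h x

lemma hasDerivAt_integral_interpolation (hv : 0 < v) (hφ : LipschitzWith Λ φ) (hψ : ExpLip ψ)
    (θ : ℝ) :
    Integrable (fun p : EuclideanSpace ℝ (Fin n) × EuclideanSpace ℝ (Fin n) =>
      fderiv ℝ φ (Real.cos θ • p.1 + Real.sin θ • p.2)
        (-Real.sin θ • p.1 + Real.cos θ • p.2) * ψ p.1)
      ((isoGaussian n v).prod (isoGaussian n v)) ∧
    HasDerivAt (fun θ : ℝ => ∫ p, φ (Real.cos θ • p.1 + Real.sin θ • p.2) * ψ p.1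
        ∂((isoGaussian n v).prod (isoGaussian n v)))
      (∫ p, fderiv ℝ φ (Real.cos θ • p.1 + Real.sin θ • p.2)
        (-Real.sin θ • p.1 + Real.cos θ • p.2) * ψ p.1
        ∂((isoGaussian n v).prod (isoGaussian n v))) θ := by
  have hcφ := hφ.continuous
  have hcψ := hψ.continuous
  have hexp : ∀ x y : EuclideanSpace ℝ (Fin n),
      1 + ‖x‖ + ‖y‖ ≤ Real.exp (1 * ‖x‖) * Real.exp (1 * ‖y‖) := by
    intro x y
    rw [← Real.exp_add]
    linarith [Real.add_one_le_exp (1 * ‖x‖ + 1 * ‖y‖)]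
  have hint : Integrable (fun p : EuclideanSpace ℝ (Fin n) × EuclideanSpace ℝ (Fin n) =>
      φ (Real.cos θ • p.1 + Real.sin θ • p.2) * ψ p.1)
      ((isoGaussian n v).prod (isoGaussian n v)) := by
    refine (integrable_interpolation_bound hv hψ (|φ 0| + Λ)).mono'
      (Continuous.aestronglyMeasurable (by fun_prop)) (Eventually.of_forall fun p => ?_)
    rw [norm_mul, mul_assoc, mul_right_comm, ← mul_assoc, Real.norm_eq_abs (ψ p.1)]
    refine mul_le_mul_of_nonneg_right ?_ (abs_nonneg _)
    have h1 := hφ.norm_sub_le (Real.cos θ • p.1 + Real.sin θ • p.2) 0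
    have h2 := norm_le_norm_add_norm_sub' (φ (Real.cos θ • p.1 + Real.sin θ • p.2)) (φ 0)
    rw [sub_zero] at h1
    have h3 : ‖Real.cos θ • p.1 + Real.sin θ • p.2‖ ≤ ‖p.1‖ + ‖p.2‖ := by
      refine (norm_add_le _ _).trans ?_
      rw [norm_smul, norm_smul, Real.norm_eq_abs, Real.norm_eq_abs]
      exact add_le_add (mul_le_of_le_one_left (norm_nonneg _) (Real.abs_cos_le_one θ))
        (mul_le_of_le_one_left (norm_nonneg _) (Real.abs_sin_le_one θ))
    have h4 := hexp p.1 p.2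
    rw [Real.norm_eq_abs (φ 0)] at h2
    have h5 : ‖p.1‖ + ‖p.2‖ ≤ Real.exp (1 * ‖p.1‖) * Real.exp (1 * ‖p.2‖) := by linarith
    have h6 : 1 ≤ Real.exp (1 * ‖p.1‖) * Real.exp (1 * ‖p.2‖) := by
      linarith [norm_nonneg p.1, norm_nonneg p.2]
    calc _ ≤ |φ 0| * 1 + Λ * (‖p.1‖ + ‖p.2‖) := by
          have : (Λ : ℝ) * ‖Real.cos θ • p.1 + Real.sin θ • p.2‖ ≤ Λ * (‖p.1‖ + ‖p.2‖) := by gcongr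
          linarith
      _ ≤ |φ 0| * (Real.exp (1 * ‖p.1‖) * Real.exp (1 * ‖p.2‖)) +
          Λ * (Real.exp (1 * ‖p.1‖) * Real.exp (1 * ‖p.2‖)) := by gcongr
      _ = _ := by ring
  refine hasDerivAt_integral_of_dominated_loc_of_lip (s := Set.univ) Filter.univ_mem
    (Eventually.of_forall fun t => Continuous.aestronglyMeasurable (by fun_prop)) hint ?_
    (Eventually.of_forall fun p => ?_) (integrable_interpolation_bound hv hψ Λ) ?_
  · refine (Measurable.mul ?_ (hcψ.measurable.comp measurable_fst)).aestronglyMeasurable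
    have hm : Measurable fun q : (EuclideanSpace ℝ (Fin n) →L[ℝ] ℝ) × EuclideanSpace ℝ (Fin n) =>
        q.1 q.2 := isBoundedBilinearMap_apply.continuous.measurable
    exact hm.comp (((measurable_fderiv ℝ φ).comp (by fun_prop)).prodMk (by fun_prop))
  · refine LipschitzOnWith.of_dist_le_mul fun s _ t _ => ?_
    rw [Real.coe_nnabs, abs_of_nonneg (by positivity), Real.dist_eq, Real.dist_eq, ← sub_mul,
      abs_mul]
    have h1 := hφ.norm_sub_le (Real.cos s • p.1 + Real.sin s • p.2)
      (Real.cos t • p.1 + Real.sin t • p.2)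
    rw [Real.norm_eq_abs] at h1
    have h2 : ‖Real.cos s • p.1 + Real.sin s • p.2 - (Real.cos t • p.1 + Real.sin t • p.2)‖ ≤
        |s - t| * (‖p.1‖ + ‖p.2‖) := by
      rw [add_sub_add_comm, ← sub_smul, ← sub_smul, mul_add]
      refine (norm_add_le _ _).trans ?_
      rw [norm_smul, norm_smul, Real.norm_eq_abs, Real.norm_eq_abs]
      exact add_le_add (mul_le_mul_of_nonneg_right (Real.abs_cos_sub_cos_le s t) (norm_nonneg _))
        (mul_le_mul_of_nonneg_right (Real.abs_sin_sub_sin_le s t) (norm_nonneg _))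
    have h5 : ‖p.1‖ + ‖p.2‖ ≤ Real.exp (1 * ‖p.1‖) * Real.exp (1 * ‖p.2‖) := by
      linarith [hexp p.1 p.2]
    calc _ ≤ (Λ * (|s - t| * (Real.exp (1 * ‖p.1‖) * Real.exp (1 * ‖p.2‖)))) * |ψ p.1| := by
          gcongr
          refine h1.trans ?_
          gcongr
          refine h2.trans ?_
          gcongr
      _ = _ := by ring
  -- For each fixed `θ` the point `cos θ p.1 + sin θ p.2` is again Gaussian, so it is almost surely
  -- a point of differentiability of `φ`.
  · have hd := (measurePreserving_cos_smul_add_sin_smul (n := n) (v := v) θ).quasiMeasurePreserving.ae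
      (hφ.expLip.ae_differentiableAt_isoGaussian hv)
    filter_upwards [hd] with p hp
    refine HasDerivAt.mul_const ?_ _
    have h' : HasDerivAt (fun t : ℝ => Real.cos t • p.1 + Real.sin t • p.2)
        (-Real.sin θ • p.1 + Real.cos θ • p.2) θ :=
      ((Real.hasDerivAt_cos θ).smul_const p.1).add ((Real.hasDerivAt_sin θ).smul_const p.2)
    exact hp.hasFDerivAt.comp_hasDerivAt θ h'

/-- For fixed `u` the derivative of `φ` at `u` is a linear form `⟪a, ·⟫` with `‖a‖ ≤ Λ`, so Stein's
lemma in `w` moves it onto `ψ`; the chain rule supplies the factor `s`. -/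
lemma abs_integral_fderiv_mul_comp_le (hv : 0 < v) (hφ : LipschitzWith Λ φ) (hψ : ExpLip ψ)
    (u z : EuclideanSpace ℝ (Fin n)) {s : ℝ} (hs : |s| ≤ 1) :
    |∫ w, fderiv ℝ φ u w * ψ (z + s • w) ∂isoGaussian n v| ≤
      ∫ w, v * |s| * Λ * ‖fderiv ℝ ψ (z + s • w)‖ ∂isoGaussian n v := by
  obtain ⟨a, ha⟩ := (InnerProductSpace.toDual ℝ (EuclideanSpace ℝ (Fin n))).surjective
    (fderiv ℝ φ u)
  have hna : ‖a‖ ≤ Λ := by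
    rw [← (InnerProductSpace.toDual ℝ (EuclideanSpace ℝ (Fin n))).norm_map a, ha]
    exact norm_fderiv_le_of_lipschitz ℝ hφ
  have hfd : ∀ w, fderiv ℝ (fun w => ψ (z + s • w)) w = s • fderiv ℝ ψ (z + s • w) := by
    intro w
    have h := fderiv_comp_smul (𝕜 := ℝ) (f := fun y => ψ (z + y)) (x := w) s
    rw [fderiv_comp_add_left] at h
    exact h
  have hst := (hψ.comp_affine z s hs).stein hv a
  have hi := (hψ.comp_affine z s hs).integrable_fderiv hv
  simp_rw [hfd] at hst hi
  simp_rw [← ha, InnerProductSpace.toDual_apply_apply]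
  rw [hst, ← integral_const_mul]
  rw [← Real.norm_eq_abs]
  refine (norm_integral_le_integral_norm _).trans (integral_mono_of_nonneg
    (Eventually.of_forall fun _ => norm_nonneg _) ?_ (Eventually.of_forall fun w => ?_))
  · have := hi.norm.const_mul (v * Λ)
    refine this.congr (Eventually.of_forall fun w => ?_)
    simp only [norm_smul, Real.norm_eq_abs]
    ring
  · simp only [smul_apply, smul_eq_mul, norm_mul, Real.norm_eq_abs v,
      Real.norm_eq_abs s, abs_of_pos hv]
    rw [mul_assoc v, mul_assoc v, mul_assoc |s|]
    gcongr
    refine ((fderiv ℝ ψ (z + s • w)).le_opNorm a).trans ?_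
    rw [mul_comm]
    gcongr

lemma abs_deriv_integral_interpolation_le (hv : 0 < v) (hφ : LipschitzWith Λ φ) (hψ : ExpLip ψ)
    (θ : ℝ) :
    |∫ p, fderiv ℝ φ (Real.cos θ • p.1 + Real.sin θ • p.2)
        (-Real.sin θ • p.1 + Real.cos θ • p.2) * ψ p.1
        ∂((isoGaussian n v).prod (isoGaussian n v))| ≤
      v * |Real.sin θ| * Λ * ∫ x, ‖fderiv ℝ ψ x‖ ∂isoGaussian n v := by
  have hi := (hasDerivAt_integral_interpolation hv hφ hψ θ).1
  set γ2 := (isoGaussian n v).prod (isoGaussian n v)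
  -- In the rotated coordinates `(u, w)`, which have the same law, the original first coordinate is
  -- `cos θ u - sin θ w`. The gradient of `φ` now depends on `u` alone.
  let G : EuclideanSpace ℝ (Fin n) × EuclideanSpace ℝ (Fin n) → ℝ := fun q =>
    fderiv ℝ φ q.1 q.2 * ψ (Real.cos θ • q.1 + (-Real.sin θ) • q.2)
  have hGm : Measurable G := by
    have hm : Measurable fun q : (EuclideanSpace ℝ (Fin n) →L[ℝ] ℝ) × EuclideanSpace ℝ (Fin n) =>
        q.1 q.2 := isBoundedBilinearMap_apply.continuous.measurable
    exact (hm.comp (((measurable_fderiv ℝ φ).comp measurable_fst).prodMk measurable_snd)).mul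
      (hψ.continuous.measurable.comp (by fun_prop))
  have hG : ∀ p : EuclideanSpace ℝ (Fin n) × EuclideanSpace ℝ (Fin n),
      fderiv ℝ φ (Real.cos θ • p.1 + Real.sin θ • p.2)
        (-Real.sin θ • p.1 + Real.cos θ • p.2) * ψ p.1 = G (ContinuousLinearMap.rotation θ p) := by
    intro p
    rw [ContinuousLinearMap.rotation_apply]
    simp only [G]
    congr 2
    have := Real.sin_sq_add_cos_sq θ
    rw [smul_add, smul_add, smul_smul, smul_smul, smul_smul, smul_smul, add_add_add_comm,
      ← add_smul, ← add_smul]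
    rw [show Real.cos θ * Real.cos θ + -Real.sin θ * -Real.sin θ = 1 by linarith [this],
      show Real.cos θ * Real.sin θ + -Real.sin θ * Real.cos θ = 0 by ring]
    simp
  simp_rw [hG] at hi ⊢
  have hrot := measurePreserving_rotation (n := n) (v := v) θ
  have hGi : Integrable G γ2 := (hrot.integrable_comp hGm.aestronglyMeasurable).1 hi
  have h1 : ∫ p, G (ContinuousLinearMap.rotation θ p) ∂γ2 = ∫ q, G q ∂γ2 := by
    rw [← integral_map hrot.measurable.aemeasurable (by rw [hrot.map_eq]; exact hGi.1), hrot.map_eq]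
  have hH : MeasurePreserving (fun q : EuclideanSpace ℝ (Fin n) × EuclideanSpace ℝ (Fin n) =>
      Real.cos θ • q.1 + (-Real.sin θ) • q.2) γ2 (isoGaussian n v) := by
    have := measurePreserving_cos_smul_add_sin_smul (n := n) (v := v) (-θ)
    rwa [Real.cos_neg, Real.sin_neg] at this
  have hnm : AEStronglyMeasurable (fun x => ‖fderiv ℝ ψ x‖) (isoGaussian n v) :=
    (measurable_fderiv ℝ ψ).norm.aestronglyMeasurable
  have hDi : Integrable (fun q : EuclideanSpace ℝ (Fin n) × EuclideanSpace ℝ (Fin n) =>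
      v * |-Real.sin θ| * Λ * ‖fderiv ℝ ψ (Real.cos θ • q.1 + (-Real.sin θ) • q.2)‖) γ2 :=
    ((hH.integrable_comp hnm).2 (hψ.integrable_fderiv hv).norm).const_mul _
  have h2 : ∫ q : EuclideanSpace ℝ (Fin n) × EuclideanSpace ℝ (Fin n),
      v * |-Real.sin θ| * Λ * ‖fderiv ℝ ψ (Real.cos θ • q.1 + (-Real.sin θ) • q.2)‖ ∂γ2 =
      v * |Real.sin θ| * Λ * ∫ x, ‖fderiv ℝ ψ x‖ ∂isoGaussian n v := by
    rw [integral_const_mul, abs_neg]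
    congr 1
    rw [← hH.map_eq, integral_map hH.measurable.aemeasurable (by rw [hH.map_eq]; exact hnm)]
  rw [h1, ← h2, integral_prod _ hGi, integral_prod _ hDi, ← Real.norm_eq_abs]
  refine (norm_integral_le_integral_norm _).trans (integral_mono_of_nonneg
    (Eventually.of_forall fun _ => norm_nonneg _) hDi.integral_prod_left
    (Eventually.of_forall fun u => ?_))
  simp only [Real.norm_eq_abs, G]
  exact abs_integral_fderiv_mul_comp_le hv hφ hψ u _
    (by rw [abs_neg]; exact Real.abs_sin_le_one θ)

/-- A Gaussian covariance inequality. -/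
theorem integral_mul_sub_le (hv : 0 < v) (hφ : LipschitzWith Λ φ) (hψ : ExpLip ψ) :
    ∫ x, φ x * ψ x ∂isoGaussian n v - (∫ x, φ x ∂isoGaussian n v) * ∫ x, ψ x ∂isoGaussian n v ≤
      v * Λ * ∫ x, ‖fderiv ℝ ψ x‖ ∂isoGaussian n v := by
  set I := ∫ x, ‖fderiv ℝ ψ x‖ ∂isoGaussian n v
  set Φ : ℝ → ℝ := fun θ => ∫ p, φ (Real.cos θ • p.1 + Real.sin θ • p.2) * ψ p.1
        ∂((isoGaussian n v).prod (isoGaussian n v))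
  have hd : ∀ θ, HasDerivAt (fun θ => Φ θ - v * Λ * I * Real.cos θ) _ θ := fun θ =>
    (hasDerivAt_integral_interpolation hv hφ hψ θ).2.sub
      ((Real.hasDerivAt_cos θ).const_mul (v * Λ * I))
  -- `Φ` runs from `E φψ` at `0` to `Eφ Eψ` at `π/2` with slope at least `-v Λ I sin θ`; adding `-v
  -- Λ I cos θ` makes it monotone.
  have hmono : MonotoneOn (fun θ => Φ θ - v * Λ * I * Real.cos θ) (Set.Icc 0 (Real.pi / 2)) := by
    refine monotoneOn_of_deriv_nonneg (convex_Icc _ _)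
      (fun θ _ => (hd θ).continuousAt.continuousWithinAt)
      (fun θ _ => (hd θ).differentiableAt.differentiableWithinAt) fun θ hθ => ?_
    rw [(hd θ).deriv]
    rw [interior_Icc] at hθ
    have h1 := abs_deriv_integral_interpolation_le hv hφ hψ θ
    rw [abs_of_nonneg (Real.sin_nonneg_of_nonneg_of_le_pi hθ.1.le
      (by linarith [hθ.2, Real.pi_pos]))] at h1
    have h2 := (abs_le.1 h1).1
    linarith
  have h := hmono (Set.left_mem_Icc.2 (by positivity)) (Set.right_mem_Icc.2 (by positivity))
    (by positivity : (0 : ℝ) ≤ Real.pi / 2)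
  have h0 : Φ 0 = ∫ x, φ x * ψ x ∂isoGaussian n v := by
    simp only [Φ, Real.cos_zero, Real.sin_zero, one_smul, zero_smul, add_zero]
    rw [integral_fun_fst (fun x => φ x * ψ x)]
    simp
  have h1 : Φ (Real.pi / 2) = (∫ x, φ x ∂isoGaussian n v) * ∫ x, ψ x ∂isoGaussian n v := by
    simp only [Φ, Real.cos_pi_div_two, Real.sin_pi_div_two, one_smul, zero_smul, zero_add]
    simp_rw [mul_comm (φ _)]
    rw [integral_prod_mul, mul_comm]
  simp only [Real.cos_zero, Real.cos_pi_div_two, h0, h1] at h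
  linarith

/-- The Gaussian Poincaré inequality for Lipschitz functions. -/
theorem LipschitzWith.gaussian_poincare (hv : 0 < v) (hφ : LipschitzWith Λ φ) :
    ∫ x, (φ x - ∫ z, φ z ∂isoGaussian n v) ^ 2 ∂isoGaussian n v ≤ v * Λ ^ 2 := by
  set c := ∫ z, φ z ∂isoGaussian n v with hc
  have hφi := hφ.expLip.integrable hv
  have h := integral_mul_sub_le hv hφ hφ.expLip
  have h2 : ∫ x, ‖fderiv ℝ φ x‖ ∂isoGaussian n v ≤ Λ := by
    calc _ ≤ ∫ x, (Λ : ℝ) ∂isoGaussian n v :=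
          integral_mono (hφ.expLip.integrable_fderiv hv).norm (integrable_const _)
            fun x => norm_fderiv_le_of_lipschitz ℝ hφ
      _ = Λ := by simp
  have h3 : ∫ x, (φ x - c) ^ 2 ∂isoGaussian n v = ∫ x, φ x * φ x ∂isoGaussian n v - c * c := by
    have e : ∀ x, (φ x - c) ^ 2 = φ x * φ x - 2 * c * φ x + c ^ 2 := fun x => by ring
    simp_rw [e]
    have hi : Integrable (fun x => φ x * φ x - 2 * c * φ x) (isoGaussian n v) :=
      ((hφ.expLip.mul hφ.expLip).integrable hv).sub (hφi.const_mul _)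
    rw [integral_add hi (integrable_const _), integral_sub ((hφ.expLip.mul hφ.expLip).integrable hv)
      (hφi.const_mul _), integral_const_mul, ← hc]
    simp
    ring
  rw [h3]
  refine h.trans ?_
  rw [pow_two, ← mul_assoc]
  gcongr

/-- The covariance inequality with `ψ = exp (t φ)` gives the differential inequality `M'(t) ≤ v Λ² t
M(t)`. Hence `M(t) exp(-v Λ² t²/2)` decreases on `[0, ∞)` from the value `1`. -/
lemma LipschitzWith.mgf_le (hv : 0 < v) (hφ : LipschitzWith Λ φ)
    (h0 : ∫ x, φ x ∂isoGaussian n v = 0) {t : ℝ} (ht : 0 ≤ t) :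
    mgf φ (isoGaussian n v) t ≤ Real.exp (v * Λ ^ 2 * t ^ 2 / 2) := by
  have hset : integrableExpSet φ (isoGaussian n v) = Set.univ :=
    Set.eq_univ_of_forall fun t => (hφ.expLip_exp t).integrable hv
  have hd : ∀ t, HasDerivAt (mgf φ (isoGaussian n v))
      (∫ x, φ x * Real.exp (t * φ x) ∂isoGaussian n v) t := fun t =>
    hasDerivAt_mgf (by rw [hset]; simp)
  have hle : ∀ t, 0 ≤ t → ∫ x, φ x * Real.exp (t * φ x) ∂isoGaussian n v ≤
      v * Λ ^ 2 * t * mgf φ (isoGaussian n v) t := by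
    intro t ht
    have h := integral_mul_sub_le hv hφ (hφ.expLip_exp t)
    rw [h0, zero_mul, sub_zero] at h
    refine h.trans ?_
    have : ∫ x, ‖fderiv ℝ (fun x => Real.exp (t * φ x)) x‖ ∂isoGaussian n v ≤
        ∫ x, t * Λ * Real.exp (t * φ x) ∂isoGaussian n v := by
      refine integral_mono_ae ((hφ.expLip_exp t).integrable_fderiv hv).norm
        (((hφ.expLip_exp t).integrable hv).const_mul _) ?_
      filter_upwards [hφ.expLip.ae_differentiableAt_isoGaussian hv] with x hx
      have := (hx.hasFDerivAt.const_mul t).exp.fderiv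
      simp only [this, norm_smul, Real.norm_eq_abs, abs_of_nonneg ht, abs_of_pos (Real.exp_pos _)]
      rw [mul_comm]
      gcongr
      exact norm_fderiv_le_of_lipschitz ℝ hφ
    rw [integral_const_mul] at this
    calc _ ≤ v * Λ * (t * Λ * ∫ x, Real.exp (t * φ x) ∂isoGaussian n v) := by gcongr
      _ = _ := by rw [mgf]; ring
  have hd2 : ∀ t, HasDerivAt (fun t => mgf φ (isoGaussian n v) t *
      Real.exp (-(v * Λ ^ 2 * t ^ 2 / 2))) _ t := fun t => (hd t).mul
      (((((hasDerivAt_id t).pow 2).const_mul (v * (Λ : ℝ) ^ 2)).div_const 2).neg.exp)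
  have hanti : AntitoneOn (fun t => mgf φ (isoGaussian n v) t *
      Real.exp (-(v * Λ ^ 2 * t ^ 2 / 2))) (Set.Ici 0) := by
    refine antitoneOn_of_deriv_nonpos (convex_Ici _)
      (fun t _ => (hd2 t).continuousAt.continuousWithinAt)
      (fun t _ => (hd2 t).differentiableAt.differentiableWithinAt) fun t ht => ?_
    rw [(hd2 t).deriv]
    rw [interior_Ici] at ht
    have h1 := hle t (le_of_lt ht)
    have h2 := Real.exp_pos (-(v * Λ ^ 2 * t ^ 2 / 2))
    simp only [id, Nat.cast_ofNat, Pi.pow_apply]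
    have h3 := mul_le_mul_of_nonneg_right h1 h2.le
    norm_num
    linarith
  have h := hanti (Set.mem_Ici.2 le_rfl) (Set.mem_Ici.2 ht) ht
  simp only [mgf_zero, ne_eq, OfNat.ofNat_ne_zero, not_false_eq_true, zero_pow, mul_zero, zero_div,
    neg_zero, Real.exp_zero, mul_one] at h
  rwa [Real.exp_neg, ← div_eq_mul_inv, div_le_one (Real.exp_pos _)] at h

/-- Gaussian concentration for Lipschitz functions. -/
theorem LipschitzWith.gaussian_concentration (hv : 0 < v) (hΛ : 0 < Λ) (hφ : LipschitzWith Λ φ)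
    {u : ℝ} (hu : 0 ≤ u) :
    (isoGaussian n v).real {x | ∫ z, φ z ∂isoGaussian n v + u ≤ φ x} ≤
      Real.exp (-u ^ 2 / (2 * v * Λ ^ 2)) := by
  set c := ∫ z, φ z ∂isoGaussian n v with hc
  have hΛ' : (0 : ℝ) < Λ := hΛ
  have hφ' : LipschitzWith Λ fun x => φ x - c := by
    refine LipschitzWith.of_dist_le_mul fun x y => ?_
    rw [dist_sub_right]
    exact hφ.dist_le_mul x y
  have h0 : ∫ x, (φ x - c) ∂isoGaussian n v = 0 := by
    rw [integral_sub (hφ.expLip.integrable hv) (integrable_const _)]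
    simp [hc]
  -- The Chernoff parameter minimising `-t u + v Λ² t²/2`.
  have ht : 0 ≤ u / (v * Λ ^ 2) := by positivity
  have h1 := measure_ge_le_exp_mul_mgf (μ := isoGaussian n v) (X := fun x => φ x - c) u ht
    ((hφ'.expLip_exp _).integrable hv)
  have hset : {x | c + u ≤ φ x} = {x | u ≤ φ x - c} := by
    ext x; simp [le_sub_iff_add_le']
  rw [hset]
  refine h1.trans ?_
  calc _ ≤ Real.exp (-(u / (v * Λ ^ 2)) * u) *
        Real.exp (v * Λ ^ 2 * (u / (v * Λ ^ 2)) ^ 2 / 2) := by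
        gcongr
        exact hφ'.mgf_le hv h0 ht
    _ = _ := by
        rw [← Real.exp_add]
        congr 1
        field_simp
        ring

end Covariance

/-! ### Growth bounds for derivatives, which need not be continuous -/

section ExpBdd

variable {E : Type*} [NormedAddCommGroup E] {f g : E → ℝ}

/-- Functions of at most exponential growth. -/
def ExpBdd (f : E → ℝ) : Prop := ∃ K : ℝ, 0 ≤ K ∧ ∀ x, |f x| ≤ K * Real.exp (K * ‖x‖)

lemma ExpLip.expBdd (hf : ExpLip f) : ExpBdd f :=
  let ⟨K, hK, h, _⟩ := hf
  ⟨K, hK, h⟩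

lemma ExpBdd.mono (hg : ExpBdd g) (h : ∀ x, |f x| ≤ |g x|) : ExpBdd f :=
  let ⟨K, hK, h1⟩ := hg
  ⟨K, hK, fun x => (h x).trans (h1 x)⟩

lemma ExpBdd.add (hf : ExpBdd f) (hg : ExpBdd g) : ExpBdd fun x => f x + g x := by
  obtain ⟨a, ha, h1⟩ := hf
  obtain ⟨b, hb, h2⟩ := hg
  refine ⟨a + b, by positivity, fun x => (abs_add_le _ _).trans ?_⟩
  rw [add_mul]
  refine add_le_add ((h1 x).trans ?_) ((h2 x).trans ?_)
  all_goals
    refine mul_le_mul_of_nonneg_left (Real.exp_le_exp.2 ?_) (by assumption)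
    nlinarith [norm_nonneg x]

lemma ExpBdd.mul (hf : ExpBdd f) (hg : ExpBdd g) : ExpBdd fun x => f x * g x := by
  obtain ⟨a, ha, h1⟩ := hf
  obtain ⟨b, hb, h2⟩ := hg
  refine ⟨a * b + a + b, by positivity, fun x => ?_⟩
  rw [abs_mul]
  calc |f x| * |g x| ≤ a * Real.exp (a * ‖x‖) * (b * Real.exp (b * ‖x‖)) :=
        mul_le_mul (h1 x) (h2 x) (abs_nonneg _) (by positivity)
    _ = a * b * Real.exp ((a + b) * ‖x‖) := by rw [add_mul, Real.exp_add]; ring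
    _ ≤ _ := by
      have h3 : 0 ≤ a * b := mul_nonneg ha hb
      have h4 : a * b ≤ a * b + a + b := by linarith
      have h5 : a + b ≤ a * b + a + b := by linarith
      gcongr

lemma expBdd_const (c : ℝ) : ExpBdd fun _ : E => c := (expLip_const c).expBdd

lemma ExpBdd.const_mul (hf : ExpBdd f) (c : ℝ) : ExpBdd fun x => c * f x := (expBdd_const c).mul hf

lemma ExpBdd.sub (hf : ExpBdd f) (hg : ExpBdd g) : ExpBdd fun x => f x - g x := by
  simpa [sub_eq_add_neg] using hf.add (hg.const_mul (-1))

lemma ExpBdd.abs (hf : ExpBdd f) : ExpBdd fun x => |f x| := hf.mono fun x => by simp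

lemma ExpLip.expBdd_fderiv [NormedSpace ℝ E] (hf : ExpLip f) (a : E) :
    ExpBdd fun x => fderiv ℝ f x a := by
  obtain ⟨K, hK, h⟩ := hf.norm_fderiv_le
  have : ExpBdd fun x : E => ‖a‖ * (K * Real.exp (K * ‖x‖)) :=
    ExpBdd.const_mul ⟨K, hK, fun x => by rw [abs_of_nonneg (by positivity)]⟩ _
  refine this.mono fun x => ?_
  rw [abs_of_nonneg (a := ‖a‖ * _) (by positivity), mul_comm]
  refine ((fderiv ℝ f x).le_opNorm a).trans ?_
  gcongr
  exact h x

lemma ExpBdd.integrable {n : ℕ} {v : ℝ} {f : EuclideanSpace ℝ (Fin n) → ℝ} (hv : 0 < v)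
    (hf : ExpBdd f) (hm : AEStronglyMeasurable f (isoGaussian n v)) :
    Integrable f (isoGaussian n v) :=
  let ⟨_, _, h⟩ := hf
  integrable_of_exp_bound hv hm h

end ExpBdd

/-! ### Integration by parts twice, smooth case -/

section SecondOrder

variable {n : ℕ} {v : ℝ} {u w : EuclideanSpace ℝ (Fin n) → ℝ}

/-- The adjoint of `v ∂ᵢ` in `L²` of the Gaussian measure of variance `v`. -/
noncomputable def gaussAdj (v : ℝ) (i : Fin n) (u : EuclideanSpace ℝ (Fin n) → ℝ)
    (x : EuclideanSpace ℝ (Fin n)) : ℝ :=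
  x i * u x - v * fderiv ℝ u x (EuclideanSpace.single i 1)

lemma expLip_coord (i : Fin n) : ExpLip fun x : EuclideanSpace ℝ (Fin n) => x i :=
  ContinuousLinearMap.expLip (EuclideanSpace.proj i)

lemma ExpLip.expBdd_gaussAdj (hu : ExpLip u) (i : Fin n) : ExpBdd (gaussAdj v i u) :=
  (((expLip_coord i).mul hu).expBdd).sub ((hu.expBdd_fderiv _).const_mul _)

lemma measurable_gaussAdj (hu : Continuous u) (i : Fin n) : Measurable (gaussAdj v i u) := by
  unfold gaussAdj
  have := measurable_fderiv_apply_const ℝ u (EuclideanSpace.single i 1)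
  have h2 := hu.measurable
  fun_prop

lemma ExpLip.stein_coord (hv : 0 < v) (hu : ExpLip u) (i : Fin n) :
    ∫ x, x i * u x ∂isoGaussian n v =
      v * ∫ x, fderiv ℝ u x (EuclideanSpace.single i 1) ∂isoGaussian n v := by
  rw [← hu.stein hv]
  simp [EuclideanSpace.inner_single_left]

/-- Stein's lemma for the product `u w`, with the Leibniz rule holding almost everywhere. -/
lemma ExpLip.integral_gaussAdj_mul (hv : 0 < v) (hu : ExpLip u) (hw : ExpLip w) (i : Fin n) :
    ∫ x, gaussAdj v i u x * w x ∂isoGaussian n v =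
      v * ∫ x, u x * fderiv ℝ w x (EuclideanSpace.single i 1) ∂isoGaussian n v := by
  have h := (hu.mul hw).stein_coord hv i
  have m1 := measurable_fderiv_apply_const ℝ u (EuclideanSpace.single i 1)
  have m2 := measurable_fderiv_apply_const ℝ w (EuclideanSpace.single i 1)
  have i1 : Integrable (fun x => fderiv ℝ u x (EuclideanSpace.single i 1) * w x)
      (isoGaussian n v) :=
    ((hu.expBdd_fderiv _).mul hw.expBdd).integrable hv
      (m1.mul hw.continuous.measurable).aestronglyMeasurable
  have i2 : Integrable (fun x => u x * fderiv ℝ w x (EuclideanSpace.single i 1))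
      (isoGaussian n v) :=
    (hu.expBdd.mul (hw.expBdd_fderiv _)).integrable hv
      (hu.continuous.measurable.mul m2).aestronglyMeasurable
  have h2 : ∫ x, fderiv ℝ (fun x => u x * w x) x (EuclideanSpace.single i 1) ∂isoGaussian n v =
      ∫ x, (u x * fderiv ℝ w x (EuclideanSpace.single i 1) +
        fderiv ℝ u x (EuclideanSpace.single i 1) * w x) ∂isoGaussian n v := by
    refine integral_congr_ae ?_
    filter_upwards [hu.ae_differentiableAt_isoGaussian hv, hw.ae_differentiableAt_isoGaussian hv]
      with x h1 h2
    rw [fderiv_fun_mul h1 h2]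
    simp [mul_comm]
  rw [h2, integral_add i2 i1, mul_add] at h
  have h3 : ∀ x, gaussAdj v i u x * w x =
      x i * (u x * w x) - v * (fderiv ℝ u x (EuclideanSpace.single i 1) * w x) := fun x => by
    rw [gaussAdj]; ring
  simp_rw [h3]
  rw [integral_sub (((expLip_coord i).mul (hu.mul hw)).integrable hv) (i1.const_mul v), h,
    integral_const_mul]
  ring

lemma ExpLip.integral_gaussAdj (hv : 0 < v) (hu : ExpLip u) (i : Fin n) :
    ∫ x, gaussAdj v i u x ∂isoGaussian n v = 0 := by
  simpa using hu.integral_gaussAdj_mul hv (expLip_const 1) i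

/-- The adjoint on `u` is moved over, commuted past the adjoint on `w`, and then the second adjoint
is moved back. Only `w` needs second derivatives; `u` is merely `ExpLip`. -/
lemma integral_gaussAdj_mul_gaussAdj_of_contDiff (hv : 0 < v) (hu : ExpLip u)
    (hw2 : ContDiff ℝ 2 w) (hw : ExpLip w)
    (hdw : ∀ i, ExpLip fun x => fderiv ℝ w x (EuclideanSpace.single i 1)) (i j : Fin n) :
    ∫ x, gaussAdj v i u x * gaussAdj v j w x ∂isoGaussian n v =
      v * (if i = j then ∫ x, u x * w x ∂isoGaussian n v else 0) +
      v ^ 2 * ∫ x, fderiv ℝ u x (EuclideanSpace.single j 1) *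
        fderiv ℝ w x (EuclideanSpace.single i 1) ∂isoGaussian n v := by
  have hW : ExpLip (gaussAdj v j w) := ((expLip_coord j).mul hw).sub ((hdw j).const_mul v)
  have hdiff : ∀ x, DifferentiableAt ℝ (fderiv ℝ w) x := fun x =>
    (hw2.fderiv_right (m := 1) (by norm_num)).differentiable (by norm_num) x
  have hfd : ∀ (a b : EuclideanSpace ℝ (Fin n)) x,
      fderiv ℝ (fun y => fderiv ℝ w y a) x b = fderiv ℝ (fderiv ℝ w) x b a := by
    intro a b x
    have := ((hdiff x).hasFDerivAt.clm_apply (hasFDerivAt_const a x)).fderiv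
    rw [this]
    simp
  have hsymm : ∀ (a b : EuclideanSpace ℝ (Fin n)) x,
      fderiv ℝ (fun y => fderiv ℝ w y a) x b = fderiv ℝ (fun y => fderiv ℝ w y b) x a := by
    intro a b x
    rw [hfd, hfd]
    exact (hw2.contDiffAt.isSymmSndFDerivAt (by simp)).eq b a
  -- The commutation relation between `∂ᵢ` and the `j`-th adjoint; it relies on the symmetry of
  -- second derivatives.
  have hdW : ∀ x, fderiv ℝ (gaussAdj v j w) x (EuclideanSpace.single i 1) =
      (if i = j then w x else 0) +
        gaussAdj v j (fun y => fderiv ℝ w y (EuclideanSpace.single i 1)) x := by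
    intro x
    have h1 : HasFDerivAt (fun y : EuclideanSpace ℝ (Fin n) => y j)
        (EuclideanSpace.proj j : EuclideanSpace ℝ (Fin n) →L[ℝ] ℝ) x :=
      (EuclideanSpace.proj j : EuclideanSpace ℝ (Fin n) →L[ℝ] ℝ).hasFDerivAt
    have h2 : HasFDerivAt w (fderiv ℝ w x) x := (hw2.differentiable (by norm_num) x).hasFDerivAt
    have h3 : HasFDerivAt (fun y => fderiv ℝ w y (EuclideanSpace.single j 1))
        (fderiv ℝ (fun y => fderiv ℝ w y (EuclideanSpace.single j 1)) x) x :=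
      ((hdiff x).clm_apply (differentiableAt_const _)).hasFDerivAt
    have h := ((h1.mul h2).sub (h3.const_mul v)).fderiv
    rw [show gaussAdj v j w = fun y => y j * w y -
      v * fderiv ℝ w y (EuclideanSpace.single j 1) from rfl]
    erw [h]
    have hp : (EuclideanSpace.proj j : EuclideanSpace ℝ (Fin n) →L[ℝ] ℝ)
        (EuclideanSpace.single i 1) = if i = j then 1 else 0 := by
      simp [eq_comm]
    simp only [sub_apply, add_apply, smul_apply, smul_eq_mul, hp]
    rw [hsymm (EuclideanSpace.single j 1) (EuclideanSpace.single i 1) x, gaussAdj]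
    split_ifs <;> ring
  rw [hu.integral_gaussAdj_mul hv hW i]
  simp_rw [hdW, mul_add]
  have e : ∀ x, u x * gaussAdj v j (fun y => fderiv ℝ w y (EuclideanSpace.single i 1)) x =
      gaussAdj v j (fun y => fderiv ℝ w y (EuclideanSpace.single i 1)) x * u x :=
    fun x => mul_comm _ _
  have i1 : Integrable (fun x => u x * if i = j then w x else 0) (isoGaussian n v) := by
    split_ifs
    · exact (hu.mul hw).integrable hv
    · simp
  have i2 : Integrable (fun x =>
      u x * gaussAdj v j (fun y => fderiv ℝ w y (EuclideanSpace.single i 1)) x)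
      (isoGaussian n v) :=
    (hu.expBdd.mul ((hdw i).expBdd_gaussAdj j)).integrable hv
      (hu.continuous.measurable.mul (measurable_gaussAdj (hdw i).continuous j)).aestronglyMeasurable
  rw [integral_add i1 i2]
  simp_rw [e]
  rw [(hdw i).integral_gaussAdj_mul hv hu j]
  have e2 : ∫ x, u x * (if i = j then w x else 0) ∂isoGaussian n v =
      if i = j then ∫ x, u x * w x ∂isoGaussian n v else 0 := by
    split_ifs <;> simp
  rw [e2]
  simp_rw [mul_comm (fderiv ℝ w _ _)]
  ring

end SecondOrder

/-! ### Smooth approximation of Lipschitz functions -/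

section Mollification

open scoped Convolution

lemma LipschitzWith.lipschitzWith_convolution {E F F' G : Type*} [NormedAddCommGroup E]
    [NormedSpace ℝ E] [FiniteDimensional ℝ E] [MeasurableSpace E] [BorelSpace E]
    [NormedAddCommGroup F] [NormedSpace ℝ F] [NormedAddCommGroup F'] [NormedSpace ℝ F']
    [NormedAddCommGroup G] [NormedSpace ℝ G] {μ : Measure E} [μ.IsAddHaarMeasure]
    {f : E → F} {g : E → F'} {Λ : ℝ≥0} (hg : LipschitzWith Λ g) (L : F →L[ℝ] F' →L[ℝ] G)
    (hf : Continuous f) (hcf : HasCompactSupport f) :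
    ∃ K, LipschitzWith K (f ⋆[L, μ] g) := by
  have hi : ∀ x, Integrable (fun t => L (f t) (g (x - t))) μ := fun x =>
    (hcf.convolutionExists_left L hf (hg.continuous.locallyIntegrable)) x
  have hfi : Integrable (fun t => ‖f t‖) μ := (hf.integrable_of_hasCompactSupport hcf).norm
  refine ⟨Real.toNNReal (‖L‖ * Λ * ∫ t, ‖f t‖ ∂μ), LipschitzWith.of_dist_le_mul fun x y => ?_⟩
  have h0 : 0 ≤ ∫ t, ‖f t‖ ∂μ := integral_nonneg fun _ => norm_nonneg _
  rw [Real.coe_toNNReal _ (by positivity), dist_eq_norm, convolution_def, convolution_def,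
    ← integral_sub (hi x) (hi y)]
  calc _ ≤ ∫ t, ‖L‖ * Λ * dist x y * ‖f t‖ ∂μ := by
        refine (norm_integral_le_integral_norm _).trans (integral_mono_of_nonneg
          (Eventually.of_forall fun _ => norm_nonneg _) (hfi.const_mul _)
          (Eventually.of_forall fun t => ?_))
        simp only [← map_sub]
        have h1 := (L (f t)).le_opNorm (g (x - t) - g (y - t))
        have h2 := L.le_opNorm (f t)
        have h3 := hg.dist_le_mul (x - t) (y - t)
        rw [dist_sub_right, dist_eq_norm] at h3
        calc _ ≤ ‖L‖ * ‖f t‖ * (Λ * dist x y) := h1.trans (by gcongr)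
          _ = _ := by ring
    _ = _ := by rw [integral_const_mul]; ring

variable {n : ℕ} {Λ : ℝ≥0} {w : EuclideanSpace ℝ (Fin n) → ℝ}

/-- Difference quotients of `w` along `a` are bounded by `Λ ‖a‖` and converge almost everywhere, so
dominated convergence applies. Writing the derivative as a mollified gradient gives both the uniform
bound and the almost everywhere convergence of gradients. -/
lemma LipschitzWith.fderiv_convolution_normed (hw : LipschitzWith Λ w)
    (η : ContDiffBump (0 : EuclideanSpace ℝ (Fin n))) (x a : EuclideanSpace ℝ (Fin n)) :
    fderiv ℝ (η.normed volume ⋆[ContinuousLinearMap.lsmul ℝ ℝ, volume] w) x a =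
      (η.normed volume ⋆[ContinuousLinearMap.lsmul ℝ ℝ, volume] fun y => fderiv ℝ w y a) x := by
  have hcd : ContDiff ℝ 1 (η.normed volume ⋆[ContinuousLinearMap.lsmul ℝ ℝ, volume] w) :=
    η.hasCompactSupport_normed.contDiff_convolution_left (n := 1) _ η.contDiff_normed
      hw.continuous.locallyIntegrable
  have h1 := (hcd.differentiable (by norm_num) x).hasFDerivAt
  have h' : HasDerivAt (fun t : ℝ => x + t • a) a 0 := by
    simpa using ((hasDerivAt_id (0 : ℝ)).smul_const a).const_add x
  have h2 : HasDerivAt (fun t : ℝ => (η.normed volume ⋆[ContinuousLinearMap.lsmul ℝ ℝ, volume] w)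
      (x + t • a))
      (fderiv ℝ (η.normed volume ⋆[ContinuousLinearMap.lsmul ℝ ℝ, volume] w) x a) 0 := by
    have h1' : HasFDerivAt (η.normed volume ⋆[ContinuousLinearMap.lsmul ℝ ℝ, volume] w)
        (fderiv ℝ (η.normed volume ⋆[ContinuousLinearMap.lsmul ℝ ℝ, volume] w) x)
        (x + (0 : ℝ) • a) := by simpa using h1
    exact h1'.comp_hasDerivAt (0 : ℝ) h'
  refine h2.unique ?_
  have hηc := η.continuous_normed (μ := (volume : Measure (EuclideanSpace ℝ (Fin n))))
  have hwc := hw.continuous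
  have hηi := η.integrable_normed (μ := (volume : Measure (EuclideanSpace ℝ (Fin n))))
  refine (hasDerivAt_integral_of_dominated_loc_of_lip (s := Set.univ)
    (F := fun (s : ℝ) t => η.normed volume t • w (x + s • a - t))
    (F' := fun t => η.normed volume t • fderiv ℝ w (x - t) a)
    (bound := fun t => Λ * ‖a‖ * η.normed volume t) Filter.univ_mem
    (Eventually.of_forall fun t => Continuous.aestronglyMeasurable (by fun_prop)) ?_ ?_
    (Eventually.of_forall fun t => ?_) (hηi.const_mul _) ?_).2
  · have := (η.hasCompactSupport_normed (μ := (volume : Measure (EuclideanSpace ℝ (Fin n))))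
      ).convolutionExists_left (ContinuousLinearMap.lsmul ℝ ℝ) hηc
      (hwc.locallyIntegrable (μ := volume)) x
    simpa [ConvolutionExistsAt] using this
  · exact (hηc.measurable.smul ((measurable_fderiv_apply_const ℝ w a).comp
      (measurable_const.sub measurable_id))).aestronglyMeasurable
  · refine LipschitzOnWith.of_dist_le_mul fun s _ r _ => ?_
    have hη := η.nonneg_normed (μ := (volume : Measure (EuclideanSpace ℝ (Fin n)))) t
    rw [Real.coe_nnabs, abs_of_nonneg (by positivity), Real.dist_eq, Real.dist_eq, ← smul_sub,
      smul_eq_mul, abs_mul, abs_of_nonneg hη]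
    have h3 := hw.dist_le_mul (x + s • a - t) (x + r • a - t)
    rw [dist_sub_right, dist_add_left, dist_eq_norm (s • a), ← sub_smul, norm_smul, Real.dist_eq,
      Real.norm_eq_abs] at h3
    calc _ ≤ η.normed volume t * (Λ * (|s - r| * ‖a‖)) := by gcongr
      _ = _ := by ring
  · have hd := (Measure.measurePreserving_sub_left (volume : Measure (EuclideanSpace ℝ (Fin n)))
      x).quasiMeasurePreserving.ae (hw.ae_differentiableAt (μ := volume))
    filter_upwards [hd] with t ht
    change HasDerivAt (fun s : ℝ => η.normed volume t * w (x + s • a - t))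
      (η.normed volume t * fderiv ℝ w (x - t) a) 0
    refine HasDerivAt.const_mul _ ?_
    have h' : HasDerivAt (fun s : ℝ => x + s • a - t) a 0 := h'.sub_const t
    exact HasFDerivAt.comp_hasDerivAt 0 (by simpa using ht.hasFDerivAt) h'

/-- Lipschitz functions can be approximated by smooth functions, together with their first
derivatives. -/
lemma LipschitzWith.exists_mollification (hw : LipschitzWith Λ w) :
    ∃ W : ℕ → EuclideanSpace ℝ (Fin n) → ℝ, (∀ k, ContDiff ℝ 2 (W k)) ∧ (∀ k, ExpLip (W k)) ∧
      (∀ k a, ExpLip fun x => fderiv ℝ (W k) x a) ∧ (∀ k x, |W k x - w x| ≤ Λ) ∧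
      (∀ k x a, |fderiv ℝ (W k) x a| ≤ Λ * ‖a‖) ∧
      (∀ x, Tendsto (fun k => W k x) atTop (𝓝 (w x))) ∧
      ∀ a, ∀ᵐ x, Tendsto (fun k => fderiv ℝ (W k) x a) atTop (𝓝 (fderiv ℝ w x a)) := by
  -- The radii have fixed ratio `2`, as Lebesgue differentiation requires; outer radii at most one
  -- give the uniform distance `Λ` to `w`.
  let η : ℕ → ContDiffBump (0 : EuclideanSpace ℝ (Fin n)) := fun k =>
    ⟨1 / 2 * (1 / ((k : ℝ) + 1)), 1 / ((k : ℝ) + 1), by positivity, by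
      have : (0 : ℝ) < 1 / ((k : ℝ) + 1) := by positivity
      linarith⟩
  have hη : Tendsto (fun k => (η k).rOut) atTop (𝓝 0) := tendsto_one_div_add_atTop_nhds_zero_nat
  have hη1 : ∀ k, (η k).rOut ≤ 1 := fun k => by
    change 1 / ((k : ℝ) + 1) ≤ 1
    rw [div_le_one (by positivity)]
    simp
  have hwl := hw.continuous.locallyIntegrable (μ := volume)
  have hbd : ∀ x a, |fderiv ℝ w x a| ≤ Λ * ‖a‖ := fun x a =>
    ((fderiv ℝ w x).le_opNorm a).trans (by gcongr; exact norm_fderiv_le_of_lipschitz ℝ hw)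
  refine ⟨fun k => (η k).normed volume ⋆[ContinuousLinearMap.lsmul ℝ ℝ, volume] w, fun k => ?_,
    fun k => ?_, fun k a => ?_, fun k x => ?_, fun k x a => ?_, fun x => ?_, fun a => ?_⟩
  · exact ((η k).hasCompactSupport_normed (μ := volume)).contDiff_convolution_left (n := 2) _
      (η k).contDiff_normed hwl
  · obtain ⟨K, hK⟩ := hw.lipschitzWith_convolution (μ := volume) (ContinuousLinearMap.lsmul ℝ ℝ)
      ((η k).continuous_normed (μ := volume)) (η k).hasCompactSupport_normed
    exact hK.expLip
  -- To see that the derivative is itself Lipschitz, it is put on the bump instead of on `w`.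
  · have hcd : ContDiff ℝ 1 ((η k).normed (volume : Measure (EuclideanSpace ℝ (Fin n)))) :=
      (η k).contDiff_normed (n := 1)
    have hcs := (η k).hasCompactSupport_normed (μ := (volume : Measure (EuclideanSpace ℝ (Fin n))))
    obtain ⟨K, hK⟩ := hw.lipschitzWith_convolution (μ := volume)
      ((ContinuousLinearMap.lsmul ℝ ℝ : ℝ →L[ℝ] ℝ →L[ℝ] ℝ).precompL (EuclideanSpace ℝ (Fin n)))
      (hcd.continuous_fderiv (by norm_num)) (hcs.fderiv (𝕜 := ℝ))
    have e : (fun x => fderiv ℝ ((η k).normed volume ⋆[ContinuousLinearMap.lsmul ℝ ℝ, volume] w)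
        x a) = fun x => ContinuousLinearMap.apply ℝ ℝ a
        ((fderiv ℝ ((η k).normed volume) ⋆[(ContinuousLinearMap.lsmul ℝ ℝ).precompL _, volume] w)
          x) := by
      ext x
      rw [(hcs.hasFDerivAt_convolution_left (ContinuousLinearMap.lsmul ℝ ℝ) hcd hwl x).fderiv]
      rfl
    rw [e]
    exact ((ContinuousLinearMap.apply ℝ ℝ a).lipschitz.comp hK).expLip
  · rw [← Real.dist_eq]
    refine (η k).dist_normed_convolution_le hw.continuous.aestronglyMeasurable fun y hy => ?_
    refine (hw.dist_le_mul y x).trans (mul_le_of_le_one_right Λ.2 ?_)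
    exact (Metric.mem_ball.1 hy).le.trans (hη1 k)
  · simp only []
    rw [hw.fderiv_convolution_normed, convolution_def, ← Real.norm_eq_abs]
    have hi := (η k).integrable_normed (μ := (volume : Measure (EuclideanSpace ℝ (Fin n))))
    calc _ ≤ ∫ t, Λ * ‖a‖ * (η k).normed volume t := by
          refine (norm_integral_le_integral_norm _).trans (integral_mono_of_nonneg
            (Eventually.of_forall fun _ => norm_nonneg _) (hi.const_mul _)
            (Eventually.of_forall fun t => ?_))
          have h0 := (η k).nonneg_normed (μ := (volume : Measure (EuclideanSpace ℝ (Fin n)))) t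
          simp only [ContinuousLinearMap.lsmul_apply, smul_eq_mul, norm_mul, Real.norm_eq_abs,
            abs_of_nonneg h0]
          rw [mul_comm]
          have := hbd (x - t) a
          gcongr
      _ = _ := by rw [integral_const_mul, (η k).integral_normed, mul_one]
  · exact ContDiffBump.convolution_tendsto_right_of_continuous (μ := volume) hη hw.continuous x
  · have hl : LocallyIntegrable (fun y => fderiv ℝ w y a)
        (volume : Measure (EuclideanSpace ℝ (Fin n))) := by
      refine (locallyIntegrable_const (Λ * ‖a‖ : ℝ)).mono
        (measurable_fderiv_apply_const ℝ w a).aestronglyMeasurable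
        (Eventually.of_forall fun y => (hbd y a).trans (le_abs_self _))
    have := ContDiffBump.ae_convolution_tendsto_right_of_locallyIntegrable (K := 2) hη
      (Eventually.of_forall fun k => by
        change 1 / ((k : ℝ) + 1) ≤ 2 * (1 / 2 * (1 / ((k : ℝ) + 1)))
        linarith) hl
    filter_upwards [this] with x hx
    simp only [hw.fderiv_convolution_normed]
    exact hx

end Mollification

/-! ### Integration by parts twice, Lipschitz case -/

section SecondOrderStein

variable {n : ℕ} {v : ℝ} {Λ : ℝ≥0} {u w : EuclideanSpace ℝ (Fin n) → ℝ}

/-- The smooth identity contains only first derivatives of `w`. These converge almost everywhere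
along the mollifications and stay bounded by `Λ`, so every term passes to the limit by domination.
-/
lemma LipschitzWith.integral_gaussAdj_mul_gaussAdj (hv : 0 < v) (hu : ExpLip u)
    (hw : LipschitzWith Λ w) (i j : Fin n) :
    ∫ x, gaussAdj v i u x * gaussAdj v j w x ∂isoGaussian n v =
      v * (if i = j then ∫ x, u x * w x ∂isoGaussian n v else 0) +
      v ^ 2 * ∫ x, fderiv ℝ u x (EuclideanSpace.single j 1) *
        fderiv ℝ w x (EuclideanSpace.single i 1) ∂isoGaussian n v := by
  obtain ⟨W, hW2, hW, hdW, hWb, hdWb, hWt, hdWt⟩ := hw.exists_mollification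
  have hdWt' : ∀ a, ∀ᵐ x ∂isoGaussian n v,
      Tendsto (fun k => fderiv ℝ (W k) x a) atTop (𝓝 (fderiv ℝ w x a)) := fun a =>
    (isoGaussian_absolutelyContinuous hv).ae_le (hdWt a)
  have hW' : ∀ k x, |W k x| ≤ |w x| + Λ := fun k x => by
    have := abs_sub_abs_le_abs_sub (W k x) (w x)
    linarith [hWb k x]
  have hdWb1 : ∀ k x i, |fderiv ℝ (W k) x (EuclideanSpace.single i 1)| ≤ Λ := fun k x i => by
    simpa using hdWb k x (EuclideanSpace.single i 1)
  have hwE := hw.expLip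
  have hmdu : ∀ i, Measurable fun x => fderiv ℝ u x (EuclideanSpace.single i 1) := fun i =>
    measurable_fderiv_apply_const ℝ u _
  have hb1 : Integrable (fun x => |gaussAdj v i u x| * (|x j| * (|w x| + Λ) + v * Λ))
      (isoGaussian n v) := by
    refine ExpBdd.integrable hv ((hu.expBdd_gaussAdj i).abs.mul
      (((expLip_coord j).expBdd.abs.mul (hwE.expBdd.abs.add (expBdd_const _))).add
        (expBdd_const _))) (Measurable.aestronglyMeasurable ?_)
    have h1 := measurable_gaussAdj (v := v) hu.continuous i
    have h2 := hw.continuous.measurable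
    have h3 : Measurable fun x => |gaussAdj v i u x| := continuous_abs.measurable.comp h1
    have h4 : Measurable fun x => |w x| := continuous_abs.measurable.comp h2
    have h5 : Measurable fun x : EuclideanSpace ℝ (Fin n) => |x j| :=
      continuous_abs.measurable.comp (by fun_prop)
    fun_prop
  have hb2 : Integrable (fun x => |u x| * (|w x| + Λ)) (isoGaussian n v) := by
    refine ExpBdd.integrable hv (hu.expBdd.abs.mul (hwE.expBdd.abs.add (expBdd_const _)))
      (Continuous.aestronglyMeasurable ?_)
    have := hu.continuous
    have := hw.continuous
    fun_prop
  have hb3 : Integrable (fun x => |fderiv ℝ u x (EuclideanSpace.single j 1)| * Λ)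
      (isoGaussian n v) := by
    refine ExpBdd.integrable hv ((hu.expBdd_fderiv _).abs.mul (expBdd_const _))
      (Measurable.aestronglyMeasurable ?_)
    exact (continuous_abs.measurable.comp (hmdu j)).mul_const _
  have t1 : Tendsto (fun k => ∫ x, gaussAdj v i u x * gaussAdj v j (W k) x ∂isoGaussian n v) atTop
      (𝓝 (∫ x, gaussAdj v i u x * gaussAdj v j w x ∂isoGaussian n v)) := by
    refine tendsto_integral_of_dominated_convergence _ (fun k =>
      ((measurable_gaussAdj hu.continuous i).mul
        (measurable_gaussAdj (hW k).continuous j)).aestronglyMeasurable) hb1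
      (fun k => Eventually.of_forall fun x => ?_) ?_
    · rw [norm_mul, Real.norm_eq_abs, Real.norm_eq_abs]
      refine mul_le_mul_of_nonneg_left ?_ (abs_nonneg _)
      refine (abs_sub _ _).trans ?_
      rw [abs_mul, abs_mul, abs_of_pos hv]
      have := hW' k x
      have := hdWb1 k x j
      gcongr
    · filter_upwards [hdWt' (EuclideanSpace.single j 1)] with x hx
      exact (((hWt x).const_mul _).sub (hx.const_mul _)).const_mul _
  have t2 : Tendsto (fun k => if i = j then ∫ x, u x * W k x ∂isoGaussian n v else 0) atTop
      (𝓝 (if i = j then ∫ x, u x * w x ∂isoGaussian n v else 0)) := by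
    split_ifs
    · refine tendsto_integral_of_dominated_convergence _ (fun k =>
        (hu.continuous.mul (hW k).continuous).aestronglyMeasurable) hb2
        (fun k => Eventually.of_forall fun x => ?_)
        (Eventually.of_forall fun x => (hWt x).const_mul _)
      rw [norm_mul, Real.norm_eq_abs, Real.norm_eq_abs]
      exact mul_le_mul_of_nonneg_left (hW' k x) (abs_nonneg _)
    · exact tendsto_const_nhds
  have t3 : Tendsto (fun k => ∫ x, fderiv ℝ u x (EuclideanSpace.single j 1) *
        fderiv ℝ (W k) x (EuclideanSpace.single i 1) ∂isoGaussian n v) atTop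
      (𝓝 (∫ x, fderiv ℝ u x (EuclideanSpace.single j 1) *
        fderiv ℝ w x (EuclideanSpace.single i 1) ∂isoGaussian n v)) := by
    refine tendsto_integral_of_dominated_convergence _ (fun k =>
      ((hmdu j).mul (hdW k _).continuous.measurable).aestronglyMeasurable) hb3
      (fun k => Eventually.of_forall fun x => ?_) ?_
    · rw [norm_mul, Real.norm_eq_abs, Real.norm_eq_abs]
      exact mul_le_mul_of_nonneg_left (hdWb1 k x i) (abs_nonneg _)
    · filter_upwards [hdWt' (EuclideanSpace.single i 1)] with x hx
      exact hx.const_mul _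
  refine tendsto_nhds_unique t1 ?_
  have := (t2.const_mul v).add (t3.const_mul (v ^ 2))
  refine this.congr fun k => ?_
  rw [integral_gaussAdj_mul_gaussAdj_of_contDiff hv hu (hW2 k) (hW k) (fun i => hdW k _)]

end SecondOrderStein

/-! ### The Gaussian divergence of a Lipschitz field -/

section VectorFields

variable {n : ℕ} {v : ℝ} {L : ℝ≥0} {g h : EuclideanSpace ℝ (Fin n) → EuclideanSpace ℝ (Fin n)}

/-- The Gaussian divergence `⟪x, g(x)⟫ - v div g(x)` of a vector field. -/
noncomputable def steinDiv (v : ℝ) (g : EuclideanSpace ℝ (Fin n) → EuclideanSpace ℝ (Fin n))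
    (x : EuclideanSpace ℝ (Fin n)) : ℝ :=
  ⟪x, g x⟫ - v * (gradMatrix g x).trace

lemma LipschitzWith.coord (hg : LipschitzWith L g) (i : Fin n) :
    LipschitzWith L fun x => g x i := by
  refine LipschitzWith.of_dist_le_mul fun x y => le_trans ?_ (hg.dist_le_mul x y)
  rw [dist_eq_norm, dist_eq_norm, ← PiLp.sub_apply]
  exact PiLp.norm_apply_le _ i

lemma gradMatrix_apply_of_differentiableAt {x : EuclideanSpace ℝ (Fin n)}
    (hg : DifferentiableAt ℝ g x) (a i : Fin n) :
    gradMatrix g x a i = fderiv ℝ (fun y => g y i) x (EuclideanSpace.single a 1) := by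
  have := ((EuclideanSpace.proj i : EuclideanSpace ℝ (Fin n) →L[ℝ] ℝ).hasFDerivAt.comp x
    hg.hasFDerivAt).fderiv
  change _ = fderiv ℝ (⇑(EuclideanSpace.proj i : EuclideanSpace ℝ (Fin n) →L[ℝ] ℝ) ∘ g) x _
  rw [this]
  rfl

lemma gradMatrix_sub {x : EuclideanSpace ℝ (Fin n)}
    (hg : DifferentiableAt ℝ g x) (hh : DifferentiableAt ℝ h x) :
    gradMatrix (fun y => g y - h y) x = gradMatrix g x - gradMatrix h x := by
  ext a i
  simp [gradMatrix, fderiv_fun_sub hg hh]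

lemma steinDiv_sub {x : EuclideanSpace ℝ (Fin n)}
    (hg : DifferentiableAt ℝ g x) (hh : DifferentiableAt ℝ h x) :
    steinDiv v (fun y => g y - h y) x = steinDiv v g x - steinDiv v h x := by
  simp only [steinDiv, gradMatrix_sub hg hh, Matrix.trace_sub, inner_sub_right]
  ring

lemma LipschitzWith.ae_differentiableAt_isoGaussian (hv : 0 < v) (hg : LipschitzWith L g) :
    ∀ᵐ x ∂isoGaussian n v, DifferentiableAt ℝ g x :=
  (isoGaussian_absolutelyContinuous hv).ae_le hg.ae_differentiableAt

/-- Only almost everywhere: entries of `gradMatrix` are identified with derivatives of coordinates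
at points where the whole field is differentiable. -/
lemma LipschitzWith.steinDiv_ae_eq (hv : 0 < v) (hg : LipschitzWith L g) :
    ∀ᵐ x ∂isoGaussian n v, steinDiv v g x = ∑ i, gaussAdj v i (fun y => g y i) x := by
  filter_upwards [hg.ae_differentiableAt_isoGaussian hv] with x hx
  simp only [steinDiv, gaussAdj, Matrix.trace, Matrix.diag, Finset.sum_sub_distrib,
    ← Finset.mul_sum, gradMatrix_apply_of_differentiableAt hx, PiLp.inner_apply]
  simp [mul_comm]

lemma LipschitzWith.integral_steinDiv (hv : 0 < v) (hg : LipschitzWith L g) :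
    Integrable (steinDiv v g) (isoGaussian n v) ∧ ∫ x, steinDiv v g x ∂isoGaussian n v = 0 := by
  have hi : ∀ i, Integrable (gaussAdj v i fun y => g y i) (isoGaussian n v) := fun i =>
    ((hg.coord i).expLip.expBdd_gaussAdj i).integrable hv
      (measurable_gaussAdj (hg.coord i).continuous i).aestronglyMeasurable
  refine ⟨Integrable.congr (integrable_finsetSum Finset.univ fun i _ => hi i)
    (EventuallyEq.symm (hg.steinDiv_ae_eq hv)), ?_⟩
  · rw [integral_congr_ae (hg.steinDiv_ae_eq hv), integral_finsetSum _ fun i _ => hi i]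
    exact Finset.sum_eq_zero fun i _ => (hg.coord i).expLip.integral_gaussAdj hv i

/-- The second order Stein formula. -/
theorem LipschitzWith.integral_steinDiv_sq (hv : 0 < v) (hg : LipschitzWith L g) :
    Integrable (fun x => steinDiv v g x ^ 2) (isoGaussian n v) ∧
    ∫ x, steinDiv v g x ^ 2 ∂isoGaussian n v =
      v * ∫ x, ‖g x‖ ^ 2 ∂isoGaussian n v +
        v ^ 2 * ∫ x, (gradMatrix g x ^ 2).trace ∂isoGaussian n v := by
  have hE : ∀ i, ExpLip fun x => g x i := fun i => (hg.coord i).expLip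
  have hae : ∀ᵐ x ∂isoGaussian n v, steinDiv v g x ^ 2 =
      ∑ i, ∑ j, gaussAdj v i (fun y => g y i) x * gaussAdj v j (fun y => g y j) x := by
    filter_upwards [hg.steinDiv_ae_eq hv] with x hx
    rw [hx, pow_two, Finset.sum_mul_sum]
  have hi : ∀ i j, Integrable
      (fun x => gaussAdj v i (fun y => g y i) x * gaussAdj v j (fun y => g y j) x)
      (isoGaussian n v) := fun i j =>
    (((hE i).expBdd_gaussAdj i).mul ((hE j).expBdd_gaussAdj j)).integrable hv
      ((measurable_gaussAdj (hE i).continuous i).mul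
        (measurable_gaussAdj (hE j).continuous j)).aestronglyMeasurable
  have hi2 : ∀ i j : Fin n, Integrable (fun x =>
      fderiv ℝ (fun y => g y i) x (EuclideanSpace.single j 1) *
        fderiv ℝ (fun y => g y j) x (EuclideanSpace.single i 1)) (isoGaussian n v) := fun i j =>
    (((hE i).expBdd_fderiv _).mul ((hE j).expBdd_fderiv _)).integrable hv
      ((measurable_fderiv_apply_const ℝ _ _).mul
        (measurable_fderiv_apply_const ℝ _ _)).aestronglyMeasurable
  have hae2 : ∀ᵐ x ∂isoGaussian n v, (gradMatrix g x ^ 2).trace =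
      ∑ i, ∑ j, fderiv ℝ (fun y => g y i) x (EuclideanSpace.single j 1) *
        fderiv ℝ (fun y => g y j) x (EuclideanSpace.single i 1) := by
    filter_upwards [hg.ae_differentiableAt_isoGaussian hv] with x hx
    simp only [pow_two, Matrix.trace, Matrix.diag, Matrix.mul_apply,
      gradMatrix_apply_of_differentiableAt hx]
    rw [Finset.sum_comm]
  have hn : ∀ x, ‖g x‖ ^ 2 = ∑ i, g x i * g x i := fun x => by
    rw [EuclideanSpace.real_norm_sq_eq]
    simp [pow_two]
  refine ⟨Integrable.congr (integrable_finsetSum Finset.univ fun i _ =>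
    integrable_finsetSum Finset.univ fun j _ => hi i j) (EventuallyEq.symm hae), ?_⟩
  · rw [integral_congr_ae hae, integral_congr_ae hae2,
      integral_finsetSum _ fun i _ => integrable_finsetSum _ fun j _ => hi i j,
      integral_finsetSum _ fun i _ => integrable_finsetSum _ fun j _ => hi2 i j]
    simp_rw [hn]
    rw [integral_finsetSum _ fun i _ => ((hE i).mul (hE i)).integrable hv, Finset.mul_sum,
      Finset.mul_sum, ← Finset.sum_add_distrib]
    refine Finset.sum_congr rfl fun i _ => ?_
    rw [integral_finsetSum _ fun j _ => hi i j, integral_finsetSum _ fun j _ => hi2 i j]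
    -- The diagonal terms assemble to `E‖g‖²`, the cross derivatives to the trace of the squared
    -- gradient.
    simp_rw [(hg.coord _).integral_gaussAdj_mul_gaussAdj hv (hE i)]
    rw [Finset.sum_add_distrib, ← Finset.mul_sum, ← Finset.mul_sum]
    simp

lemma measurable_gradMatrix_apply (g : EuclideanSpace ℝ (Fin n) → EuclideanSpace ℝ (Fin n))
    (a i : Fin n) : Measurable fun x => gradMatrix g x a i := by
  have h := measurable_fderiv_apply_const ℝ g (EuclideanSpace.single a 1)
  have h2 : Measurable fun z : EuclideanSpace ℝ (Fin n) => z i := by fun_prop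
  exact h2.comp h

lemma measurable_steinDiv (hg : Continuous g) : Measurable (steinDiv v g) := by
  have h1 : Measurable fun x => (gradMatrix g x).trace := by
    simp only [Matrix.trace, Matrix.diag]
    exact Finset.measurable_sum _ fun i _ => measurable_gradMatrix_apply g i i
  exact (Continuous.measurable (by fun_prop)).sub (h1.const_mul v)

/-- `tr(A²)` is at most the squared Frobenius norm, by `xy ≤ (x² + y²)/2`, and each row of `A` is a
directional derivative along a unit vector, of norm at most `L`. -/
lemma LipschitzWith.trace_gradMatrix_sq_le (hg : LipschitzWith L g)
    (x : EuclideanSpace ℝ (Fin n)) : (gradMatrix g x ^ 2).trace ≤ n * L ^ 2 := by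
  have h1 : (gradMatrix g x ^ 2).trace ≤ ∑ a, ∑ i, gradMatrix g x a i ^ 2 := by
    simp only [pow_two (gradMatrix g x), Matrix.trace, Matrix.diag, Matrix.mul_apply]
    have h2 : ∑ a, ∑ i, gradMatrix g x a i ^ 2 =
        ∑ a, ∑ i, (gradMatrix g x a i ^ 2 + gradMatrix g x i a ^ 2) / 2 := by
      simp only [add_div, Finset.sum_add_distrib]
      rw [Finset.sum_comm (f := fun a i => gradMatrix g x i a ^ 2 / 2),
        ← Finset.sum_add_distrib]
      refine Finset.sum_congr rfl fun a _ => ?_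
      rw [← Finset.sum_add_distrib]
      exact Finset.sum_congr rfl fun i _ => by ring
    rw [h2]
    refine Finset.sum_le_sum fun a _ => Finset.sum_le_sum fun i _ => ?_
    nlinarith [sq_nonneg (gradMatrix g x a i - gradMatrix g x i a)]
  refine h1.trans ?_
  calc ∑ a, ∑ i, gradMatrix g x a i ^ 2 ≤ ∑ _a : Fin n, (L : ℝ) ^ 2 := by
        refine Finset.sum_le_sum fun a _ => ?_
        have h3 : ∑ i, gradMatrix g x a i ^ 2 =
            ‖fderiv ℝ g x (EuclideanSpace.single a 1)‖ ^ 2 := by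
          simp [EuclideanSpace.real_norm_sq_eq, gradMatrix]
        rw [h3]
        have h4 := (fderiv ℝ g x).le_opNorm (EuclideanSpace.single a 1)
        have h5 := norm_fderiv_le_of_lipschitz ℝ hg (x₀ := x)
        have h6 : ‖(EuclideanSpace.single a 1 : EuclideanSpace ℝ (Fin n))‖ = 1 := by simp
        rw [h6, mul_one] at h4
        gcongr
        exact h4.trans h5
    _ = n * L ^ 2 := by simp

end VectorFields

/-! ### Chebyshev, Minkowski and an algebraic inequality -/

section Moments

variable {Ω : Type*} [MeasurableSpace Ω] {P : Measure Ω}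

lemma measureReal_le_of_integral_sq_le [IsFiniteMeasure P] {Y : Ω → ℝ} {b c p : ℝ} (hc : 0 < c)
    (hY : Integrable (fun x => Y x ^ 2) P) (hb : ∫ x, Y x ^ 2 ∂P ≤ b) (hp : b ≤ p * c ^ 2) :
    P.real {x | c ≤ Y x} ≤ p := by
  have h := mul_meas_ge_le_integral_of_nonneg (μ := P) (f := fun x => Y x ^ 2)
    (Eventually.of_forall fun x => sq_nonneg _) hY (c ^ 2)
  have h2 : P.real {x | c ≤ Y x} ≤ P.real {x | c ^ 2 ≤ Y x ^ 2} :=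
    measureReal_mono fun x (hx : c ≤ Y x) => by
      simp only [Set.mem_ofPred_eq]
      gcongr
  have h3 : 0 < c ^ 2 := by positivity
  nlinarith

/-- Minkowski's inequality in `L²`, through Young's inequality with weights `b/a` and `a/b`; this is
why `b = 0` is treated apart. -/
lemma integral_sub_sq_le {X Y : Ω → ℝ} (hX : MemLp X 2 P) (hY : MemLp Y 2 P) {a b : ℝ} (ha : 0 < a)
    (hb : 0 ≤ b) (hXa : ∫ x, X x ^ 2 ∂P ≤ a ^ 2) (hYb : ∫ x, Y x ^ 2 ∂P ≤ b ^ 2) :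
    ∫ x, (X x - Y x) ^ 2 ∂P ≤ (a + b) ^ 2 := by
  have iX := hX.integrable_sq
  have iY := hY.integrable_sq
  rcases hb.eq_or_lt with rfl | hb
  · have h0 : ∫ x, Y x ^ 2 ∂P = 0 :=
      le_antisymm (by simpa using hYb) (integral_nonneg fun _ => sq_nonneg _)
    rw [integral_eq_zero_iff_of_nonneg (fun _ => sq_nonneg _) iY] at h0
    rw [add_zero]
    refine le_trans (le_of_eq (integral_congr_ae ?_)) hXa
    filter_upwards [h0] with x hx
    have : Y x = 0 := by simpa using hx
    simp [this]
  · have hle : ∀ x, (X x - Y x) ^ 2 ≤ (1 + b / a) * X x ^ 2 + (1 + a / b) * Y x ^ 2 := by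
      intro x
      rw [← sub_nonneg]
      have : (1 + b / a) * X x ^ 2 + (1 + a / b) * Y x ^ 2 - (X x - Y x) ^ 2 =
          (b * X x + a * Y x) ^ 2 / (a * b) := by field_simp; ring
      rw [this]; positivity
    calc ∫ x, (X x - Y x) ^ 2 ∂P
        ≤ ∫ x, ((1 + b / a) * X x ^ 2 + (1 + a / b) * Y x ^ 2) ∂P :=
          integral_mono (hX.sub hY).integrable_sq ((iX.const_mul _).add (iY.const_mul _)) hle
      _ = (1 + b / a) * ∫ x, X x ^ 2 ∂P + (1 + a / b) * ∫ x, Y x ^ 2 ∂P := by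
          rw [integral_add (iX.const_mul _) (iY.const_mul _), integral_const_mul,
            integral_const_mul]
      _ ≤ (1 + b / a) * a ^ 2 + (1 + a / b) * b ^ 2 := by gcongr
      _ = _ := by field_simp; ring

/-- The computation closing the large-distance case of `pair_tail`. There `q = √2 L + 1`, so `2 (q -
1)² v = 4 L² v` is the Poincaré bound on the variance of `‖g‖ + ‖h‖`. -/
lemma sq_add_le_of_mul_sq_le {R t q v : ℝ} (hq : 1 ≤ q) (h1 : q * t ^ 2 ≤ R ^ 2)
    (h2 : 8 * q ^ 2 * v ≤ R ^ 2) :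
    (R + (q - 1) * t / 2) ^ 2 ≤ q * (R ^ 2 - 2 * (q - 1) ^ 2 * v) := by
  obtain ⟨w, hw⟩ : ∃ w, R ^ 2 = q * w := ⟨R ^ 2 / q, by field_simp⟩
  have hq0 : 0 < q := by linarith
  have ht : t ^ 2 ≤ w := by
    rw [hw] at h1; exact le_of_mul_le_mul_left h1 hq0
  have hv : 8 * q * v ≤ w := by
    rw [hw] at h2; exact le_of_mul_le_mul_left (by linarith) hq0
  have h3 : 2 * (R * t) ≤ q * w + w := by nlinarith [sq_nonneg (R - t)]
  have h4 : (q - 1) * (2 * (R * t)) ≤ (q - 1) * (q * w + w) :=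
    mul_le_mul_of_nonneg_left h3 (by linarith)
  have h5 : (q - 1) ^ 2 * t ^ 2 ≤ (q - 1) ^ 2 * w := mul_le_mul_of_nonneg_left ht (sq_nonneg _)
  have h6 : (q - 1) ^ 2 * (8 * q * v) ≤ (q - 1) ^ 2 * w :=
    mul_le_mul_of_nonneg_left hv (sq_nonneg _)
  nlinarith

end Moments

/-! ### Comparison of one estimator with the reference estimator -/

section Pair

variable {n : ℕ} {v : ℝ} {L : ℝ≥0} {g h : EuclideanSpace ℝ (Fin n) → EuclideanSpace ℝ (Fin n)}

lemma LipschitzWith.norm_comp' (hg : LipschitzWith L g) : LipschitzWith L fun x => ‖g x‖ := by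
  have := lipschitzWith_one_norm.comp hg
  rwa [one_mul] at this

lemma ExpLip.memLp_two {f : EuclideanSpace ℝ (Fin n) → ℝ} (hv : 0 < v) (hf : ExpLip f) :
    MemLp f 2 (isoGaussian n v) := by
  rw [memLp_two_iff_integrable_sq hf.continuous.aestronglyMeasurable]
  simpa [pow_two] using (hf.mul hf).integrable hv

lemma LipschitzWith.memLp_steinDiv (hv : 0 < v) (hg : LipschitzWith L g) :
    MemLp (steinDiv v g) 2 (isoGaussian n v) := by
  rw [memLp_two_iff_integrable_sq (measurable_steinDiv hg.continuous).aestronglyMeasurable]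
  exact (hg.integral_steinDiv_sq hv).1

/-- Second moments of the sum of the norms and of the difference of two Lipschitz fields. -/
lemma integral_sq_norm_sub_le (hv : 0 < v) (hg : LipschitzWith L g) (hh : LipschitzWith L h) :
    ∫ x, ‖g x - h x‖ ^ 2 ∂isoGaussian n v ≤
      (∫ x, (‖g x‖ + ‖h x‖) ∂isoGaussian n v) ^ 2 + 4 * L ^ 2 * v ∧
    ∫ x, (‖g x‖ + ‖h x‖ - ∫ z, (‖g z‖ + ‖h z‖) ∂isoGaussian n v) ^ 2 ∂isoGaussian n v ≤
      4 * L ^ 2 * v := by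
  have hS := hg.norm_comp'.add hh.norm_comp'
  have hp := hS.gaussian_poincare hv
  set e := ∫ z, (‖g z‖ + ‖h z‖) ∂isoGaussian n v with he
  have h4 : v * ((L + L : ℝ≥0) : ℝ) ^ 2 = 4 * L ^ 2 * v := by push_cast; ring
  rw [h4] at hp
  refine ⟨?_, hp⟩
  have hSi := hS.expLip.integrable hv
  have hS2 := (hS.expLip.memLp_two hv).integrable_sq
  have e1 : ∫ x, (‖g x‖ + ‖h x‖ - e) ^ 2 ∂isoGaussian n v =
      ∫ x, (‖g x‖ + ‖h x‖) ^ 2 ∂isoGaussian n v - e ^ 2 := by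
    have hx : ∀ x, (‖g x‖ + ‖h x‖ - e) ^ 2 =
        (‖g x‖ + ‖h x‖) ^ 2 - 2 * e * (‖g x‖ + ‖h x‖) + e ^ 2 := fun x => by ring
    simp_rw [hx]
    have hi : Integrable (fun x => (‖g x‖ + ‖h x‖) ^ 2 - 2 * e * (‖g x‖ + ‖h x‖))
      (isoGaussian n v) := hS2.sub (hSi.const_mul _)
    rw [integral_add hi (integrable_const _), integral_sub hS2 (hSi.const_mul _),
      integral_const_mul, ← he]
    simp
    ring
  have e2 : ∫ x, ‖g x - h x‖ ^ 2 ∂isoGaussian n v ≤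
      ∫ x, (‖g x‖ + ‖h x‖) ^ 2 ∂isoGaussian n v := by
    refine integral_mono (((hg.sub hh).norm_comp'.expLip.memLp_two hv).integrable_sq) hS2
      fun x => ?_
    simp only
    gcongr
    exact norm_sub_le _ _
  linarith

lemma integral_two_mul_steinDiv_sq_le (hv : 0 < v) (hg : LipschitzWith L g) {s : ℝ}
    (hs : ∫ x, (gradMatrix g x ^ 2).trace ∂isoGaussian n v ≤ s) :
    ∫ x, (2 * steinDiv v g x) ^ 2 ∂isoGaussian n v ≤
      4 * (v * ∫ x, ‖g x‖ ^ 2 ∂isoGaussian n v + v ^ 2 * s) := by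
  simp_rw [mul_pow]
  rw [integral_const_mul, (hg.integral_steinDiv_sq hv).2]
  norm_num
  gcongr

/-- Chebyshev in three regimes of `R2 = E‖g - h‖²`. On the event, `2Z` exceeds both `t²` and `t (‖g‖
+ ‖h‖)`; the first fact serves when `R2` is small, the second when it is large. -/
lemma pair_tail (hv : 0 < v) (hg : LipschitzWith L g) (hh : LipschitzWith L h) {s p t : ℝ}
    (hs : ∫ x, (gradMatrix (fun y => g y - h y) x ^ 2).trace ∂isoGaussian n v ≤ s)
    (hp : 0 < p) (hp1 : p ≤ 1) (ht : 0 < t) (h4 : 8 * v ^ 2 * s ≤ p * t ^ 4)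
    (h2 : 8 * v * (√2 * L + 1) ≤ p * t ^ 2) :
    (isoGaussian n v).real {x | t < ‖g x‖ - ‖h x‖ ∧
      ‖g x‖ ^ 2 - ‖h x‖ ^ 2 ≤ 2 * steinDiv v (fun y => g y - h y) x} ≤ p := by
  have hgh := hg.sub hh
  have hZ := integral_two_mul_steinDiv_sq_le hv hgh hs
  have hZL : MemLp (fun x => 2 * steinDiv v (fun y => g y - h y) x) 2 (isoGaussian n v) :=
    (hgh.memLp_steinDiv hv).const_mul 2
  obtain ⟨hR, hS⟩ := integral_sq_norm_sub_le hv hg hh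
  set Z := steinDiv v (fun y => g y - h y)
  set R2 := ∫ x, ‖g x - h x‖ ^ 2 ∂isoGaussian n v
  set e := ∫ x, (‖g x‖ + ‖h x‖) ∂isoGaussian n v
  set q : ℝ := √2 * L + 1 with hq
  have hL0 : (0 : ℝ) ≤ L := L.2
  have hq1 : 1 ≤ q := by
    have : 0 ≤ √2 * (L : ℝ) := by positivity
    linarith
  have hR0 : 0 ≤ R2 := integral_nonneg fun _ => sq_nonneg _
  have hsub1 : {x | t < ‖g x‖ - ‖h x‖ ∧ ‖g x‖ ^ 2 - ‖h x‖ ^ 2 ≤ 2 * Z x} ⊆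
      {x | t ^ 2 ≤ 2 * Z x} := by
    rintro x ⟨hx1, hx2⟩
    simp only [Set.mem_ofPred_eq]
    have h5 : t * t ≤ (‖g x‖ - ‖h x‖) * (‖g x‖ - ‖h x‖) := mul_self_le_mul_self ht.le hx1.le
    have h6 : 0 ≤ ‖h x‖ * (‖g x‖ - ‖h x‖) := mul_nonneg (norm_nonneg _) (ht.le.trans hx1.le)
    linarith
  -- The trace term dominates: `E(2Z)² ≤ 8 v² s ≤ p t⁴`.
  by_cases hc1 : R2 ≤ v * s
  · refine (measureReal_mono hsub1).trans ?_
    refine measureReal_le_of_integral_sq_le (by positivity) hZL.integrable_sq hZ ?_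
    have h5 := mul_le_mul_of_nonneg_left hc1 hv.le
    rw [show (t ^ 2) ^ 2 = t ^ 4 by ring]
    linarith
  push Not at hc1
  have hZ' : ∫ x, (2 * Z x) ^ 2 ∂isoGaussian n v ≤ 8 * v * R2 := by
    refine hZ.trans ?_
    have h5 := mul_le_mul_of_nonneg_left hc1.le hv.le
    linarith
  -- Intermediate regime: `p E(2Z)² ≤ 8 v p R2 ≤ (8 v q)² ≤ (p t²)²`.
  by_cases hc2 : p * R2 ≤ 8 * v * q ^ 2
  · refine (measureReal_mono hsub1).trans ?_
    refine measureReal_le_of_integral_sq_le (by positivity) hZL.integrable_sq hZ' ?_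
    have h5 : (8 * v * q) ^ 2 ≤ (p * t ^ 2) ^ 2 := by gcongr
    have h6 : p * (8 * v * R2) ≤ p * (p * (t ^ 2) ^ 2) := by
      have h7 := mul_le_mul_of_nonneg_left hc2 (by positivity : 0 ≤ 8 * v)
      linarith
    exact le_of_mul_le_mul_left h6 hp
  push Not at hc2
  set R := √R2
  have hRsq : R ^ 2 = R2 := Real.sq_sqrt hR0
  have hRpos : 0 < R2 := by
    have : 0 < p * R2 := lt_of_le_of_lt (by positivity) hc2
    exact pos_of_mul_pos_right this hp.le
  have hRp : 0 < R := Real.sqrt_pos.2 hRpos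
  -- The least threshold that `h2` permits. Replacing `t` by it only enlarges the event, and it
  -- keeps the fluctuation term `t' (‖g‖ + ‖h‖ - e)` small compared with `R`.
  set t' := √(8 * v * q / p)
  have ht'sq : t' ^ 2 = 8 * v * q / p := Real.sq_sqrt (by positivity)
  have ht'p : 0 < t' := Real.sqrt_pos.2 (by positivity)
  have ht't : t' ≤ t := by
    refine Real.sqrt_le_iff.2 ⟨ht.le, ?_⟩
    rw [div_le_iff₀ hp]
    linarith
  have hsq2 : √2 ^ 2 = (2 : ℝ) := Real.sq_sqrt (by norm_num)
  have hsq2p : 0 < √2 := by positivity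
  have hLq : 2 * (L : ℝ) ^ 2 = (q - 1) ^ 2 := by
    rw [hq, add_sub_cancel_right, mul_pow, hsq2]
  have halg := sq_add_le_of_mul_sq_le (R := R) (t := t') (v := v) hq1
    (by
      rw [hRsq, ht'sq, mul_div_assoc', div_le_iff₀ hp]
      linarith)
    (by
      rw [hRsq]
      have := mul_le_of_le_one_left hR0 hp1
      linarith)
  have hqe : q * (R ^ 2 - 2 * (q - 1) ^ 2 * v) ≤ q * e ^ 2 := by
    refine mul_le_mul_of_nonneg_left ?_ (by linarith)
    rw [hRsq, ← hLq]
    linarith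
  have he0 : 0 ≤ e := integral_nonneg fun _ => by positivity
  have hepos : 0 < e := by
    refine lt_of_le_of_ne he0 fun h0 => ?_
    have h7 : 0 < (R + (q - 1) * t' / 2) ^ 2 := by
      have : 0 ≤ (q - 1) * t' / 2 := div_nonneg (mul_nonneg (by linarith) ht'p.le) (by norm_num)
      positivity
    rw [← h0] at hqe
    linarith
  -- Centring the sum at its mean `e` turns the event into a deviation of size `t' e` of an `L²`
  -- variable whose norm is bounded by Minkowski.
  have hsub2 : {x | t < ‖g x‖ - ‖h x‖ ∧ ‖g x‖ ^ 2 - ‖h x‖ ^ 2 ≤ 2 * Z x} ⊆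
      {x | t' * e ≤ 2 * Z x - t' * (‖g x‖ + ‖h x‖ - e)} := by
    rintro x ⟨hx1, hx2⟩
    simp only [Set.mem_ofPred_eq]
    have h5 := mul_le_mul_of_nonneg_right (ht't.trans hx1.le)
      (add_nonneg (norm_nonneg (g x)) (norm_nonneg (h x)))
    linarith
  have hSL : MemLp (fun x => t' * (‖g x‖ + ‖h x‖ - e)) 2 (isoGaussian n v) :=
    (((hg.norm_comp'.add hh.norm_comp').expLip.memLp_two hv).sub (memLp_const _)).const_mul t'
  set r := √v
  have hrsq : r ^ 2 = v := Real.sq_sqrt hv.le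
  have hrp : 0 < r := Real.sqrt_pos.2 hv
  have hY := integral_sub_sq_le hZL hSL (a := 2 * √2 * r * R) (b := 2 * L * r * t') (by positivity)
    (by positivity)
    (by
      refine hZ'.trans (le_of_eq ?_)
      rw [mul_pow, mul_pow, mul_pow, hsq2, hrsq, hRsq]; ring)
    (by
      simp_rw [mul_pow]
      rw [integral_const_mul, hrsq]
      have := mul_le_mul_of_nonneg_left hS (sq_nonneg t')
      linarith)
  refine (measureReal_mono hsub2).trans ?_
  refine measureReal_le_of_integral_sq_le (by positivity) (hZL.sub hSL).integrable_sq hY ?_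
  have e1 : 2 * √2 * r * R + 2 * L * r * t' = 2 * √2 * r * (R + (q - 1) * t' / 2) := by
    rw [hq, add_sub_cancel_right]
    linear_combination (-(r * L * t')) * hsq2
  rw [e1, mul_pow, mul_pow, mul_pow, hsq2, hrsq, mul_pow, ht'sq]
  have e2 : p * (8 * v * q / p * e ^ 2) = 8 * v * (q * e ^ 2) := by field_simp
  rw [e2]
  have := mul_le_mul_of_nonneg_left (halg.trans hqe) (by positivity : 0 ≤ 8 * v)
  linarith

/-- The moment analogue of `pair_tail`: a majorant with controlled mean, so that it can be summed
over all estimators when the selected index is random. The free constant `c` is chosen after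
summation. -/
lemma pair_moment (hv : 0 < v) (hg : LipschitzWith L g) (hh : LipschitzWith L h) {s c : ℝ}
    (hs : ∫ x, (gradMatrix (fun y => g y - h y) x ^ 2).trace ∂isoGaussian n v ≤ s)
    (hs0 : 0 ≤ s) (hc : 0 < c) :
    ∃ T : EuclideanSpace ℝ (Fin n) → ℝ, Integrable T (isoGaussian n v) ∧
      (∀ x, 0 ≤ T x) ∧
      (∀ x, ‖h x‖ ≤ ‖g x‖ →
        ‖g x‖ ^ 2 - ‖h x‖ ^ 2 ≤ 2 * steinDiv v (fun y => g y - h y) x →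
        (‖g x‖ - ‖h x‖) ^ 2 ≤ c / 2 + T x) ∧
      ∫ x, T x ∂isoGaussian n v ≤
        (4 * s + 16 * L ^ 2) * v ^ 2 / c + (128 + 8 * L ^ 2) * v := by
  have hgh := hg.sub hh
  have hZ := integral_two_mul_steinDiv_sq_le hv hgh hs
  have hZL : MemLp (fun x => 2 * steinDiv v (fun y => g y - h y) x) 2 (isoGaussian n v) :=
    (hgh.memLp_steinDiv hv).const_mul 2
  obtain ⟨hR, hS⟩ := integral_sq_norm_sub_le hv hg hh
  set Z := steinDiv v (fun y => g y - h y)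
  set R2 := ∫ x, ‖g x - h x‖ ^ 2 ∂isoGaussian n v
  set e := ∫ x, (‖g x‖ + ‖h x‖) ∂isoGaussian n v
  have he0 : 0 ≤ e := integral_nonneg fun _ => by positivity
  clear_value Z R2 e
  -- Small distance: the squared excess is at most `2Z`, and `2Z ≤ (2Z)²/(2c) + c/2`.
  by_cases hc1 : R2 ≤ v * s + 8 * L ^ 2 * v
  · refine ⟨fun x => (2 * Z x) ^ 2 / (2 * c), hZL.integrable_sq.div_const _,
      fun x => by positivity, fun x hx1 hx2 => ?_, ?_⟩
    · have h1 : (‖g x‖ - ‖h x‖) ^ 2 ≤ 2 * Z x := by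
        have := mul_nonneg (norm_nonneg (h x)) (sub_nonneg.2 hx1)
        linarith
      have h2 : 0 ≤ (2 * Z x - c) ^ 2 / (2 * c) := by positivity
      have h3 : (2 * Z x - c) ^ 2 / (2 * c) = (2 * Z x) ^ 2 / (2 * c) + c / 2 - 2 * Z x := by
        field_simp; ring
      linarith
    · rw [integral_div]
      have h1 : (∫ x, (2 * Z x) ^ 2 ∂isoGaussian n v) / (2 * c) ≤
          (4 * s + 16 * L ^ 2) * v ^ 2 / c := by
        rw [div_le_div_iff₀ (by positivity) hc]
        have : ∫ x, (2 * Z x) ^ 2 ∂isoGaussian n v ≤ (8 * s + 32 * L ^ 2) * v ^ 2 := by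
          refine hZ.trans ?_
          have h5 := mul_le_mul_of_nonneg_left hc1 hv.le
          linarith
        have := mul_le_mul_of_nonneg_right this hc.le
        linarith
      have h2 : 0 ≤ (128 + 8 * L ^ 2) * v := by positivity
      linarith
  · push Not at hc1
    have hvL : 0 ≤ (L : ℝ) ^ 2 * v := by positivity
    have hvs : 0 ≤ v * s := by positivity
    -- Large distance: `4 L² v` is below `R2/2`, so `R2 ≤ e² + 4 L² v` forces `e²` to be at least
    -- `R2/2`.
    have hRe : R2 ≤ 2 * e ^ 2 := by linarith
    have hep : 0 < e := by
      refine lt_of_le_of_ne he0 fun h0 => ?_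
      rw [← h0] at hRe
      linarith
    have hSL : MemLp (fun x => ‖g x‖ + ‖h x‖ - e) 2 (isoGaussian n v) :=
      ((hg.norm_comp'.add hh.norm_comp').expLip.memLp_two hv).sub (memLp_const _)
    refine ⟨fun x => 8 / e ^ 2 * (2 * Z x) ^ 2 + 2 * (‖g x‖ + ‖h x‖ - e) ^ 2,
      (hZL.integrable_sq.const_mul _).add (hSL.integrable_sq.const_mul _),
      fun x => by positivity, fun x hx1 hx2 => ?_, ?_⟩
    · set a := ‖g x‖
      set b := ‖h x‖
      have hb : 0 ≤ b := norm_nonneg _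
      have h0 : 0 ≤ 8 / e ^ 2 * (2 * Z x) ^ 2 := by positivity
      rcases le_total (a + b) (e / 2) with h1 | h1
      -- When the sum is below half its mean, the excess is at most the sum, which is at most the
      -- deviation of the sum from `e`.
      · have : (a - b) ^ 2 ≤ (e - (a + b)) ^ 2 := by
          have h2 : a - b ≤ e - (a + b) := by linarith
          have h3 : 0 ≤ a - b := by linarith
          gcongr
        linarith [sq_nonneg (a + b - e)]
      -- When the sum is at least `e/2`, the excess is bounded by `2Z` divided by `e/2`.
      · have h2 : (a - b) * (e / 2) ≤ 2 * Z x := by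
          have : (a - b) * (e / 2) ≤ (a - b) * (a + b) :=
            mul_le_mul_of_nonneg_left h1 (by linarith)
          linarith
        have h3 : ((a - b) * (e / 2)) ^ 2 ≤ (2 * Z x) ^ 2 := by
          have : 0 ≤ (a - b) * (e / 2) := mul_nonneg (by linarith) (by linarith)
          gcongr
        have h4 : (a - b) ^ 2 = 4 / e ^ 2 * ((a - b) * (e / 2)) ^ 2 := by field_simp; ring
        have h5 : 4 / e ^ 2 * ((a - b) * (e / 2)) ^ 2 ≤ 4 / e ^ 2 * (2 * Z x) ^ 2 := by gcongr
        have h6 : 4 / e ^ 2 * (2 * Z x) ^ 2 ≤ 8 / e ^ 2 * (2 * Z x) ^ 2 := by gcongr; norm_num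
        linarith [sq_nonneg (a + b - e)]
    · rw [integral_add (hZL.integrable_sq.const_mul _) (hSL.integrable_sq.const_mul _),
        integral_const_mul, integral_const_mul]
      have h1 : ∫ x, (2 * Z x) ^ 2 ∂isoGaussian n v ≤ 16 * v * e ^ 2 := by
        refine hZ.trans ?_
        have h5 := mul_le_mul_of_nonneg_left hRe hv.le
        have h6 := mul_le_mul_of_nonneg_left hc1.le hv.le
        have h7 := mul_nonneg hv.le hvL
        linarith
      have h2 : 8 / e ^ 2 * ∫ x, (2 * Z x) ^ 2 ∂isoGaussian n v ≤ 128 * v := by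
        calc _ ≤ 8 / e ^ 2 * (16 * v * e ^ 2) := by gcongr
          _ = _ := by field_simp; norm_num
      have h3 : 0 ≤ (4 * s + 16 * L ^ 2) * v ^ 2 / c := by positivity
      linarith

end Pair

/-! ### Union bounds for events -/

section Events

variable {Ω : Type*} [MeasurableSpace Ω] {P : Measure Ω}

lemma one_sub_le_measureReal [IsProbabilityMeasure P] {bad good : Set Ω} {α : ℝ} (hbad : P.real bad ≤ α)
    (h : ∀ᵐ ω ∂P, ω ∉ bad → ω ∈ good) : 1 - α ≤ P.real good := by
  have h1 : P.real Set.univ ≤ P.real (bad ∪ good) := by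
    refine ENNReal.toReal_mono (measure_ne_top _ _) (measure_mono_ae ?_)
    filter_upwards [h] with ω hω _
    by_cases hb : ω ∈ bad
    · exact Or.inl hb
    · exact Or.inr (hω hb)
  have h2 := measureReal_union_le (μ := P) bad good
  have h3 : P.real Set.univ = 1 := by simp
  linarith

lemma one_sub_sub_le_measureReal [IsProbabilityMeasure P] {s t u : Set Ω} {α δ : ℝ} (hs : 1 - α ≤ P.real s)
    (ht : 1 - δ ≤ P.real t) (hms : NullMeasurableSet s P) (hmt : NullMeasurableSet t P)
    (h : s ∩ t ⊆ u) : 1 - α - δ ≤ P.real u := by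
  have h1 : P.real (sᶜ ∪ tᶜ) ≤ α + δ := by
    refine (measureReal_union_le _ _).trans ?_
    have e1 := probReal_compl_eq_one_sub₀ hms
    have e2 := probReal_compl_eq_one_sub₀ hmt
    linarith
  have := one_sub_le_measureReal (good := u) h1 (Eventually.of_forall fun ω hω => h (by
    simp only [Set.mem_union, Set.mem_compl_iff, not_or, not_not] at hω
    exact hω))
  linarith

/-- The inequality from a preimage to the image measure holds for arbitrary sets, so the sets `S k`
need not be measurable. -/
lemma measureReal_exists_le {E ι : Type*} [MeasurableSpace E] [Fintype ι] {ν : Measure E}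
    [IsFiniteMeasure P] [IsFiniteMeasure ν] {X : Ω → E} (hX : HasLaw X ν P) (S : ι → Set E) {p : ℝ}
    (hp : ∀ k, ν.real (S k) ≤ p) :
    P.real (⋃ k, X ⁻¹' S k) ≤ Fintype.card ι * p := by
  refine (measureReal_iUnion_fintype_le _).trans ?_
  calc ∑ k, P.real (X ⁻¹' S k) ≤ ∑ _k : ι, p := by
        refine Finset.sum_le_sum fun k _ => le_trans ?_ (hp k)
        refine ENNReal.toReal_mono (measure_ne_top _ _) ?_
        rw [← hX.map_eq]
        exact Measure.le_map_apply hX.aemeasurable _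
    _ = Fintype.card ι * p := by simp

end Events

/-! ### Bounds for the tuned estimator in centred form -/

section Tuning

variable {Ω : Type*} [MeasurableSpace Ω] {P : Measure Ω} {n m : ℕ}
  {L : ℝ≥0} {σ : ℝ} {X : Ω → EuclideanSpace ℝ (Fin n)}
  {G : Fin m → EuclideanSpace ℝ (Fin n) → EuclideanSpace ℝ (Fin n)} {k : Ω → Fin m} {j₀ : Fin m}

/-- `steinDiv` is additive only at points of differentiability. As `k ω` is random, almost sure
differentiability is needed for all indices simultaneously. -/
lemma ae_norm_sq_sub_le_of_sure (hσ : 0 < σ) (hX : HasLaw X (isoGaussian n (σ ^ 2)) P)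
    (hG : ∀ j, LipschitzWith L (G j))
    (hk : ∀ᵐ ω ∂P, ∀ j, ‖G (k ω) (X ω)‖ ^ 2 - 2 * steinDiv (σ ^ 2) (G (k ω)) (X ω) ≤
      ‖G j (X ω)‖ ^ 2 - 2 * steinDiv (σ ^ 2) (G j) (X ω)) (j : Fin m) :
    ∀ᵐ ω ∂P, ‖G (k ω) (X ω)‖ ^ 2 - ‖G j (X ω)‖ ^ 2 ≤
      2 * steinDiv (σ ^ 2) (fun x => G (k ω) x - G j x) (X ω) := by
  have hd : ∀ᵐ x ∂P.map X, ∀ j, DifferentiableAt ℝ (G j) x := by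
    rw [hX.map_eq]
    exact ae_all_iff.2 fun j => (hG j).ae_differentiableAt_isoGaussian (by positivity)
  filter_upwards [hk, ae_of_ae_map hX.aemeasurable hd] with ω h1 h2
  rw [steinDiv_sub (h2 _) (h2 _)]
  linarith [h1 j]

lemma sure_tuning_tail [IsProbabilityMeasure P] (hσ : 0 < σ) (hX : HasLaw X (isoGaussian n (σ ^ 2)) P)
    (hG : ∀ j, LipschitzWith L (G j))
    (hk : ∀ᵐ ω ∂P, ∀ j, ‖G (k ω) (X ω)‖ ^ 2 - 2 * steinDiv (σ ^ 2) (G (k ω)) (X ω) ≤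
      ‖G j (X ω)‖ ^ 2 - 2 * steinDiv (σ ^ 2) (G j) (X ω)) {s : ℝ} (hs0 : 0 ≤ s)
    (hs : ∀ j, ∫ x, (gradMatrix (fun y => G j y - G j₀ y) x ^ 2).trace
      ∂isoGaussian n (σ ^ 2) ≤ s) {α : ℝ} (hα : α ∈ Set.Ioo (0 : ℝ) 1) :
    1 - α ≤ P.real {ω | ‖G (k ω) (X ω)‖ - ‖G j₀ (X ω)‖ ≤
      σ * max ((8 * s * m / α) ^ (1 / 4 : ℝ)) ((8 * m * (√2 * L + 1) / α) ^ (1 / 2 : ℝ))} := by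
  have hα0 := hα.1
  have hm1 : 1 ≤ m := j₀.pos
  have hm : (1 : ℝ) ≤ m := by exact_mod_cast hm1
  have hv : 0 < σ ^ 2 := by positivity
  set A := 8 * s * m / α
  set B := 8 * m * (√2 * L + 1) / α
  have hA : 0 ≤ A := by positivity
  have hB : 0 < B := by positivity
  set t := σ * max (A ^ (1 / 4 : ℝ)) (B ^ (1 / 2 : ℝ))
  have hB2 : (B ^ (1 / 2 : ℝ)) ^ 2 = B := by
    rw [← Real.rpow_natCast, ← Real.rpow_mul hB.le]; norm_num
  have hA4 : (A ^ (1 / 4 : ℝ)) ^ 4 = A := by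
    rw [← Real.rpow_natCast, ← Real.rpow_mul hA]; norm_num
  have htB : σ * B ^ (1 / 2 : ℝ) ≤ t := mul_le_mul_of_nonneg_left (le_max_right _ _) hσ.le
  have htA : σ * A ^ (1 / 4 : ℝ) ≤ t := mul_le_mul_of_nonneg_left (le_max_left _ _) hσ.le
  have ht : 0 < t := lt_of_lt_of_le (by positivity) htB
  have ht2 : σ ^ 2 * B ≤ t ^ 2 := by
    rw [← hB2, ← mul_pow]; gcongr
  have ht4 : σ ^ 4 * A ≤ t ^ 4 := by
    rw [← hA4, ← mul_pow]; gcongr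
  have hp : 0 < α / m := by positivity
  have hp1 : α / m ≤ 1 := by
    rw [div_le_one (by positivity)]; linarith [hα.2]
  -- Each index gets failure probability `α / m`. The two terms of the maximum defining `t` are
  -- exactly what the two numerical hypotheses of `pair_tail` require.
  have hbad := measureReal_exists_le hX (fun j => {x | t < ‖G j x‖ - ‖G j₀ x‖ ∧
    ‖G j x‖ ^ 2 - ‖G j₀ x‖ ^ 2 ≤ 2 * steinDiv (σ ^ 2) (fun y => G j y - G j₀ y) x})
    (p := α / m) fun j => pair_tail hv (hG j) (hG j₀) (hs j) hp hp1 ht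
      (by
        refine le_trans (le_of_eq ?_) (mul_le_mul_of_nonneg_left ht4 hp.le)
        simp only [A]; field_simp)
      (by
        refine le_trans (le_of_eq ?_) (mul_le_mul_of_nonneg_left ht2 hp.le)
        simp only [B]; field_simp)
  rw [Fintype.card_fin, mul_div_cancel₀ _ (by positivity)] at hbad
  refine one_sub_le_measureReal hbad ?_
  filter_upwards [ae_norm_sq_sub_le_of_sure hσ hX hG hk j₀] with ω hω hnot
  by_contra hlt
  refine hnot (Set.mem_iUnion.2 ⟨k ω, ?_, hω⟩)
  exact not_le.1 hlt

lemma best_risk_tail [IsProbabilityMeasure P] (hσ : 0 < σ) (hX : HasLaw X (isoGaussian n (σ ^ 2)) P)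
    (hG : ∀ j, LipschitzWith L (G j))
    (hj₀ : ∀ j, ∫ x, ‖G j₀ x‖ ∂isoGaussian n (σ ^ 2) ≤ ∫ x, ‖G j x‖ ∂isoGaussian n (σ ^ 2))
    {δ : ℝ} (hδ : δ ∈ Set.Ioo (0 : ℝ) 1) :
    1 - δ ≤ P.real {ω | ‖G j₀ (X ω)‖ - ⨅ j, ‖G j (X ω)‖ ≤
      2 * L * σ * √(2 * Real.log (m / δ))} := by
  have hδ0 := hδ.1
  have hm1 : 1 ≤ m := j₀.pos
  have hm : (1 : ℝ) ≤ m := by exact_mod_cast hm1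
  have hv : 0 < σ ^ 2 := by positivity
  have : Nonempty (Fin m) := ⟨j₀⟩
  have hlog : 0 ≤ Real.log (m / δ) := Real.log_nonneg (by
    rw [le_div_iff₀ hδ0]; linarith [hδ.2])
  set u := 2 * L * σ * √(2 * Real.log (m / δ)) with hu
  have hu0 : 0 ≤ u := by positivity
  have key : ∀ j, (isoGaussian n (σ ^ 2)).real {x | u < ‖G j₀ x‖ - ‖G j x‖} ≤ δ / m := by
    intro j
    have hlip := (hG j₀).norm_comp'.sub (hG j).norm_comp'
    have hmean : ∫ x, (‖G j₀ x‖ - ‖G j x‖) ∂isoGaussian n (σ ^ 2) ≤ 0 := by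
      rw [integral_sub ((hG j₀).norm_comp'.expLip.integrable hv)
        ((hG j).norm_comp'.expLip.integrable hv)]
      linarith [hj₀ j]
    -- The concentration bound needs a positive Lipschitz constant. For `L = 0` the difference of
    -- norms is constant, equal to its nonpositive mean.
    rcases eq_or_lt_of_le (show 0 ≤ L from zero_le) with hL | hL
    · have hconst : ∀ x, ‖G j₀ x‖ - ‖G j x‖ = ‖G j₀ 0‖ - ‖G j 0‖ := fun x => by
        have := hlip.dist_le_mul x 0
        rw [← hL, add_zero, NNReal.coe_zero, zero_mul] at this
        exact dist_le_zero.1 this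
      have hemp : {x | u < ‖G j₀ x‖ - ‖G j x‖} = ∅ := by
        refine Set.eq_empty_of_forall_notMem fun x hx => ?_
        simp only [Set.mem_ofPred_eq, hconst] at hx
        simp only [hconst, integral_const, probReal_univ, one_smul] at hmean
        linarith
      rw [hemp]
      simp only [measureReal_empty]
      positivity
    · have hc := hlip.gaussian_concentration hv (add_pos hL hL) hu0
      have hL' : (0 : ℝ) < L := hL
      -- With Lipschitz constant `2L`, `u` is the level at which the Gaussian tail equals `δ / m`.
      have e1 : Real.exp (-u ^ 2 / (2 * σ ^ 2 * ((L + L : ℝ≥0) : ℝ) ^ 2)) = δ / m := by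
        have : -u ^ 2 / (2 * σ ^ 2 * ((L + L : ℝ≥0) : ℝ) ^ 2) = -Real.log (m / δ) := by
          rw [hu, mul_pow, Real.sq_sqrt (by positivity)]
          push_cast
          field_simp
          ring
        rw [this, Real.exp_neg, Real.exp_log (by positivity), inv_div]
      rw [e1] at hc
      refine le_trans (measureReal_mono fun x hx => ?_) hc
      simp only [Set.mem_ofPred_eq] at hx ⊢
      linarith
  have hbad := measureReal_exists_le hX (fun j => {x | u < ‖G j₀ x‖ - ‖G j x‖}) key
  rw [Fintype.card_fin, mul_div_cancel₀ _ (by positivity)] at hbad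
  refine one_sub_le_measureReal hbad (Eventually.of_forall fun ω hnot => ?_)
  obtain ⟨j, hj⟩ := exists_eq_ciInf_of_finite (f := fun j => ‖G j (X ω)‖)
  simp only [Set.mem_ofPred_eq]
  rw [← hj]
  by_contra hlt
  refine hnot (Set.mem_iUnion.2 ⟨j, ?_⟩)
  exact not_le.1 hlt

lemma aemeasurable_norm_tuned (hX : HasLaw X (isoGaussian n (σ ^ 2)) P)
    (hG : ∀ j, LipschitzWith L (G j)) (hkm : Measurable k) :
    AEMeasurable (fun ω => ‖G (k ω) (X ω)‖) P := by
  have h : Measurable fun p : EuclideanSpace ℝ (Fin n) × Fin m => ‖G p.2 p.1‖ :=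
    measurable_from_prod_countable_left fun j => (hG j).continuous.norm.measurable
  exact h.comp_aemeasurable (f := fun ω => (X ω, k ω)) (hX.aemeasurable.prodMk hkm.aemeasurable)

lemma aemeasurable_iInf_norm (hX : HasLaw X (isoGaussian n (σ ^ 2)) P)
    (hG : ∀ j, LipschitzWith L (G j)) :
    AEMeasurable (fun ω => ⨅ j, ‖G j (X ω)‖) P := by
  have h : Measurable fun x => ⨅ j, ‖G j x‖ :=
    Measurable.iInf fun j => (hG j).continuous.norm.measurable
  exact h.comp_aemeasurable hX.aemeasurable

lemma memLp_two_norm_comp (hσ : 0 < σ) (hX : HasLaw X (isoGaussian n (σ ^ 2)) P)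
    (hG : ∀ j, LipschitzWith L (G j)) (j : Fin m) : MemLp (fun ω => ‖G j (X ω)‖) 2 P := by
  have h := (hG j).norm_comp'.expLip.memLp_two (v := σ ^ 2) (by positivity)
  rw [← hX.map_eq] at h
  exact h.comp_of_map hX.aemeasurable

lemma memLp_two_norm_tuned (hσ : 0 < σ) (hX : HasLaw X (isoGaussian n (σ ^ 2)) P)
    (hG : ∀ j, LipschitzWith L (G j)) (hkm : Measurable k) :
    MemLp (fun ω => ‖G (k ω) (X ω)‖) 2 P := by
  have h : MemLp (fun ω => ∑ j, ‖G j (X ω)‖) 2 P :=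
    memLp_finsetSum _ fun j _ => memLp_two_norm_comp hσ hX hG j
  refine h.mono (aemeasurable_norm_tuned hX hG hkm).aestronglyMeasurable
    (Eventually.of_forall fun ω => ?_)
  rw [norm_norm, Real.norm_of_nonneg (Finset.sum_nonneg fun _ _ => norm_nonneg _)]
  exact Finset.single_le_sum (f := fun j => ‖G j (X ω)‖) (fun _ _ => norm_nonneg _)
    (Finset.mem_univ (k ω))

lemma tuned_bounds {A : Fin m → ℝ} (hA : ∀ j, 0 ≤ A j) (i : Fin m) :
    0 ≤ A i - ⨅ j, A j ∧ 0 ≤ ⨅ j, A j :=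
  have : Nonempty (Fin m) := ⟨i⟩
  ⟨sub_nonneg.2 (ciInf_le (Set.finite_range _).bddBelow i), le_ciInf hA⟩

lemma memLp_two_tuned_sub_iInf (hσ : 0 < σ) (hX : HasLaw X (isoGaussian n (σ ^ 2)) P)
    (hG : ∀ j, LipschitzWith L (G j)) (hkm : Measurable k) :
    MemLp (fun ω => ‖G (k ω) (X ω)‖ - ⨅ j, ‖G j (X ω)‖) 2 P := by
  refine (memLp_two_norm_tuned hσ hX hG hkm).mono
    ((aemeasurable_norm_tuned hX hG hkm).sub (aemeasurable_iInf_norm hX hG)).aestronglyMeasurable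
    (Eventually.of_forall fun ω => ?_)
  obtain ⟨h1, h2⟩ := tuned_bounds (A := fun j => ‖G j (X ω)‖)
    (fun _ => norm_nonneg _) (k ω)
  rw [norm_norm, Real.norm_of_nonneg h1]
  linarith

lemma sure_tuning_moment [IsProbabilityMeasure P] (hσ : 0 < σ) (hX : HasLaw X (isoGaussian n (σ ^ 2)) P)
    (hG : ∀ j, LipschitzWith L (G j)) (hkm : Measurable k)
    (hk : ∀ᵐ ω ∂P, ∀ j, ‖G (k ω) (X ω)‖ ^ 2 - 2 * steinDiv (σ ^ 2) (G (k ω)) (X ω) ≤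
      ‖G j (X ω)‖ ^ 2 - 2 * steinDiv (σ ^ 2) (G j) (X ω))
    (hj₀ : ∀ j, ∫ x, ‖G j₀ x‖ ∂isoGaussian n (σ ^ 2) ≤ ∫ x, ‖G j x‖ ∂isoGaussian n (σ ^ 2))
    {s a b : ℝ} (hs0 : 0 ≤ s)
    (hs : ∀ j, ∫ x, (gradMatrix (fun y => G j y - G j₀ y) x ^ 2).trace
      ∂isoGaussian n (σ ^ 2) ≤ s)
    (ha : 0 ≤ a) (ha4 : a ^ 4 = s * m) (hb : 0 ≤ b) (hb2 : b ^ 2 = (1 + L) ^ 2 * m) :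
    ∫ ω, (‖G (k ω) (X ω)‖ - ⨅ j, ‖G j (X ω)‖) ^ 2 ∂P ≤ (17 * σ * (a + b)) ^ 2 := by
  have hm1 : 1 ≤ m := j₀.pos
  have hm : (1 : ℝ) ≤ m := by exact_mod_cast hm1
  set v := σ ^ 2 with hvdef
  have hv : 0 < v := by positivity
  have hne : Nonempty (Fin m) := ⟨j₀⟩
  have hL0 : (0 : ℝ) ≤ L := L.2
  have hbm : (m : ℝ) ≤ b ^ 2 := by
    rw [hb2]
    have : 1 ≤ (1 + (L : ℝ)) ^ 2 := by nlinarith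
    nlinarith
  have hbp : 0 < b ^ 2 := by linarith
  -- Chosen so that `m (8 s + 32 L²) v² ≤ c²`: here `9 a⁴ ≥ 8 s m`, and `36 b⁴ ≥ 32 m L²` because
  -- `b² ≥ m L²` and `b² ≥ 1`.
  set c := v * (3 * a ^ 2 + 6 * b ^ 2) with hc
  have hcp : 0 < c := by positivity
  choose T hTi hT0 hTle hTint using fun j =>
    pair_moment hv (hG j) (hG j₀) (hs j) hs0 hcp
  set φ : Fin m → EuclideanSpace ℝ (Fin n) → ℝ := fun j x => ‖G j₀ x‖ - ‖G j x‖
  have hφL : ∀ j, LipschitzWith (L + L) (φ j) := fun j =>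
    (hG j₀).norm_comp'.sub (hG j).norm_comp'
  set e : Fin m → ℝ := fun j => ∫ x, φ j x ∂isoGaussian n v
  have he : ∀ j, e j ≤ 0 := fun j => by
    simp only [e, φ]
    rw [integral_sub ((hG j₀).norm_comp'.expLip.integrable hv)
      ((hG j).norm_comp'.expLip.integrable hv)]
    linarith [hj₀ j]
  -- Summing over all indices removes the dependence on the two random ones, the selected index and
  -- the index of the smallest loss.
  set F : EuclideanSpace ℝ (Fin n) → ℝ := fun x =>
    c + ∑ j, (2 * T j x + 2 * (φ j x - e j) ^ 2)
  have hφi : ∀ j, Integrable (fun x => (φ j x - e j) ^ 2) (isoGaussian n v) := fun j =>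
    (((hφL j).expLip.memLp_two hv).sub (memLp_const _)).integrable_sq
  have hterm : ∀ j, Integrable (fun x => 2 * T j x + 2 * (φ j x - e j) ^ 2) (isoGaussian n v) :=
    fun j => ((hTi j).const_mul 2).add ((hφi j).const_mul 2)
  have hFi : Integrable F (isoGaussian n v) :=
    (integrable_const c).add (integrable_finsetSum Finset.univ fun j _ => hterm j)
  have hle : ∀ᵐ ω ∂P, (‖G (k ω) (X ω)‖ - ⨅ j, ‖G j (X ω)‖) ^ 2 ≤ F (X ω) := by
    filter_upwards [ae_norm_sq_sub_le_of_sure hσ hX hG hk j₀] with ω hω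
    obtain ⟨h1, h2⟩ := tuned_bounds (A := fun j => ‖G j (X ω)‖)
      (fun _ => norm_nonneg _) (k ω)
    obtain ⟨j, hj⟩ := exists_eq_ciInf_of_finite (f := fun j => ‖G j (X ω)‖)
    have hBj : 0 ≤ φ j (X ω) := by
      have : ⨅ j, ‖G j (X ω)‖ ≤ ‖G j₀ (X ω)‖ := ciInf_le (Set.finite_range _).bddBelow j₀
      simp only [φ]
      linarith
    have hsum : F (X ω) = c + (∑ j, 2 * T j (X ω) + ∑ j, 2 * (φ j (X ω) - e j) ^ 2) := by
      simp only [F, Finset.sum_add_distrib]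
    have hs1 : 2 * T (k ω) (X ω) ≤ ∑ j, 2 * T j (X ω) :=
      Finset.single_le_sum (f := fun j => 2 * T j (X ω))
        (fun j _ => mul_nonneg (by norm_num) (hT0 j _)) (Finset.mem_univ (k ω))
    have hs2 : 2 * (φ j (X ω) - e j) ^ 2 ≤ ∑ j, 2 * (φ j (X ω) - e j) ^ 2 :=
      Finset.single_le_sum (f := fun j => 2 * (φ j (X ω) - e j) ^ 2)
        (fun j _ => by positivity) (Finset.mem_univ j)
    -- Since `φ j (X ω) ≥ 0 ≥ e j`, centring only increases the square.
    have hφe : φ j (X ω) ^ 2 ≤ (φ j (X ω) - e j) ^ 2 := by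
      have := he j
      have : φ j (X ω) ≤ φ j (X ω) - e j := by linarith
      gcongr
    rw [hsum]
    have hdec : ‖G (k ω) (X ω)‖ - ⨅ j, ‖G j (X ω)‖ =
        (‖G (k ω) (X ω)‖ - ‖G j₀ (X ω)‖) + φ j (X ω) := by
      rw [← hj]; simp only [φ]; ring
    rcases le_total ‖G j₀ (X ω)‖ ‖G (k ω) (X ω)‖ with hcase | hcase
    · have h3 := hTle (k ω) (X ω) hcase hω
      rw [hdec]
      nlinarith [sq_nonneg ((‖G (k ω) (X ω)‖ - ‖G j₀ (X ω)‖) - φ j (X ω))]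
    · have h3 : (‖G (k ω) (X ω)‖ - ⨅ j, ‖G j (X ω)‖) ^ 2 ≤ φ j (X ω) ^ 2 := by
        have : ‖G (k ω) (X ω)‖ - ⨅ j, ‖G j (X ω)‖ ≤ φ j (X ω) := by rw [hdec]; linarith
        gcongr
      have h4 := hT0 (k ω) (X ω)
      have h5 := sq_nonneg (φ j (X ω))
      linarith
  have hFX : Integrable (fun ω => F (X ω)) P := by
    rw [← hX.map_eq] at hFi
    exact hFi.comp_aemeasurable hX.aemeasurable
  have hFX2 : ∫ ω, F (X ω) ∂P = ∫ x, F x ∂isoGaussian n v :=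
    hX.integral_comp hFi.aestronglyMeasurable
  have hint : ∫ x, F x ∂isoGaussian n v ≤
      c + m * (2 * ((4 * s + 16 * L ^ 2) * v ^ 2 / c + (128 + 8 * L ^ 2) * v) +
        2 * (4 * L ^ 2 * v)) := by
    simp only [F]
    rw [integral_add (integrable_const c) (integrable_finsetSum Finset.univ fun j _ => hterm j),
      integral_finsetSum _ fun j _ => hterm j]
    simp only [integral_const, probReal_univ, one_smul]
    refine add_le_add le_rfl ?_
    calc _ ≤ ∑ _j : Fin m, (2 * ((4 * s + 16 * L ^ 2) * v ^ 2 / c + (128 + 8 * L ^ 2) * v) +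
        2 * (4 * L ^ 2 * v)) := by
          refine Finset.sum_le_sum fun j _ => ?_
          rw [integral_add ((hTi j).const_mul 2) ((hφi j).const_mul 2), integral_const_mul,
            integral_const_mul]
          have h1 := hTint j
          have h2 := (hφL j).gaussian_poincare hv
          have h3 : v * ((L + L : ℝ≥0) : ℝ) ^ 2 = 4 * L ^ 2 * v := by push_cast; ring
          rw [h3] at h2
          linarith
      _ = _ := by
          rw [Finset.sum_const, Finset.card_univ, Fintype.card_fin, nsmul_eq_mul]
  have hmL : (m : ℝ) * L ^ 2 ≤ b ^ 2 := by
    rw [hb2]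
    have : (L : ℝ) ^ 2 ≤ (1 + L) ^ 2 := by gcongr; linarith
    nlinarith
  have hc2 : m * (8 * s + 32 * L ^ 2) * v ^ 2 ≤ c * c := by
    have h1 : m * (8 * s + 32 * L ^ 2) ≤ (3 * a ^ 2 + 6 * b ^ 2) ^ 2 := by
      have h2 : b ^ 2 ≤ b ^ 2 * b ^ 2 := by nlinarith
      nlinarith [mul_nonneg (sq_nonneg a) (sq_nonneg b), sq_nonneg (a ^ 2)]
    rw [hc]
    have := mul_le_mul_of_nonneg_right h1 (sq_nonneg v)
    linarith
  have hc3 : m * (2 * ((4 * s + 16 * L ^ 2) * v ^ 2 / c)) ≤ c := by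
    rw [show m * (2 * ((4 * s + 16 * L ^ 2) * v ^ 2 / c)) =
      (m * (8 * s + 32 * L ^ 2) * v ^ 2) / c by ring, div_le_iff₀ hcp]
    exact hc2
  -- By `hc3` the part with `1/c` is at most another `c`. So the total is at most `v (6 a² + 283
  -- b²)`, which fits under `17² v (a + b)²`.
  have hfin : c + m * (2 * ((4 * s + 16 * L ^ 2) * v ^ 2 / c + (128 + 8 * L ^ 2) * v) +
        2 * (4 * L ^ 2 * v)) ≤ (17 * σ * (a + b)) ^ 2 := by
    have h1 : (m * (256 + 24 * L ^ 2)) * v ≤ (271 * b ^ 2) * v := by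
      refine mul_le_mul_of_nonneg_right ?_ hv.le
      have h3 : (m : ℝ) * (1 + L ^ 2) ≤ b ^ 2 := by
        rw [hb2]
        have : (1 + (L : ℝ) ^ 2) ≤ (1 + L) ^ 2 := by nlinarith
        nlinarith
      nlinarith
    have h2 : (17 * σ * (a + b)) ^ 2 = v * (289 * a ^ 2 + 289 * b ^ 2 + 578 * (a * b)) := by
      rw [hvdef]; ring
    have h4 : 0 ≤ v * (a * b) := by positivity
    have h5 : 0 ≤ v * a ^ 2 := by positivity
    have h6 : 0 ≤ v * b ^ 2 := by positivity
    rw [h2]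
    linarith
  calc _ ≤ ∫ ω, F (X ω) ∂P := integral_mono_ae
        (memLp_two_tuned_sub_iInf hσ hX hG hkm).integrable_sq hFX hle
    _ ≤ _ := by rw [hFX2]; exact hint.trans hfin

/-- Optimisation of `b / c + c` at `c = √b`; when `b = 0` this value is not allowed and `c` tends to
zero instead. -/
lemma le_two_mul_sqrt_of_forall {x b : ℝ} (hb : 0 ≤ b) (h : ∀ c, 0 < c → x ≤ b / c + c) :
    x ≤ 2 * √b := by
  rcases hb.eq_or_lt with rfl | hb
  · simp only [Real.sqrt_zero, mul_zero]
    refine le_of_forall_pos_le_add fun c hc => ?_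
    simpa using h c hc
  · have := h (√b) (Real.sqrt_pos.2 hb)
    rw [Real.div_sqrt] at this
    linarith

/-- Minimality gives `‖G k‖² ≤ ‖G j‖² - 2 Z_j + 2 Z_k`. The middle term has mean zero, and the
random-index term is at most `∑ Z_i²/c + c`, where each `E Z_i² ≤ 2 n L² σ⁴`. -/
lemma sure_tuning_risk [IsProbabilityMeasure P] (hσ : 0 < σ) (hX : HasLaw X (isoGaussian n (σ ^ 2)) P)
    (hG : ∀ j, LipschitzWith L (G j)) (hkm : Measurable k)
    (hk : ∀ᵐ ω ∂P, ∀ j, ‖G (k ω) (X ω)‖ ^ 2 - 2 * steinDiv (σ ^ 2) (G (k ω)) (X ω) ≤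
      ‖G j (X ω)‖ ^ 2 - 2 * steinDiv (σ ^ 2) (G j) (X ω))
    (hrisk : ∀ j, ∫ x, ‖G j x‖ ^ 2 ∂isoGaussian n (σ ^ 2) ≤ n * (L ^ 2 * σ ^ 2)) (j : Fin m) :
    ∫ ω, ‖G (k ω) (X ω)‖ ^ 2 ∂P - ∫ x, ‖G j x‖ ^ 2 ∂isoGaussian n (σ ^ 2) ≤
      2 * √(2 * n * m * L ^ 2 * σ ^ 4) := by
  have hv : 0 < σ ^ 2 := by positivity
  refine le_two_mul_sqrt_of_forall (by positivity) fun c hc => ?_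
  set Z : Fin m → EuclideanSpace ℝ (Fin n) → ℝ := fun i => steinDiv (σ ^ 2) (G i)
  have hZsq : ∀ i, Integrable (fun x => Z i x ^ 2) (isoGaussian n (σ ^ 2)) := fun i =>
    ((hG i).integral_steinDiv_sq hv).1
  have hZ1 : ∀ i, ∫ x, Z i x ^ 2 ∂isoGaussian n (σ ^ 2) ≤ 2 * n * L ^ 2 * σ ^ 4 := fun i => by
    rw [((hG i).integral_steinDiv_sq hv).2]
    have h1 : ∫ x, (gradMatrix (G i) x ^ 2).trace ∂isoGaussian n (σ ^ 2) ≤ n * L ^ 2 := by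
      -- Without integrability the integral is zero by convention, and the bound still holds.
      by_cases hi : Integrable (fun x => (gradMatrix (G i) x ^ 2).trace) (isoGaussian n (σ ^ 2))
      · calc _ ≤ ∫ _x, (n * L ^ 2 : ℝ) ∂isoGaussian n (σ ^ 2) :=
              integral_mono hi (integrable_const _) fun x => (hG i).trace_gradMatrix_sq_le x
          _ = _ := by simp
      · rw [integral_undef hi]; positivity
    have h2 := mul_le_mul_of_nonneg_left h1 (sq_nonneg (σ ^ 2))
    have h3 := mul_le_mul_of_nonneg_left (hrisk i) hv.le
    linarith
  have hGj : Integrable (fun x => ‖G j x‖ ^ 2) (isoGaussian n (σ ^ 2)) :=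
    ((hG j).norm_comp'.expLip.memLp_two hv).integrable_sq
  obtain ⟨hZj, hZj0⟩ := (hG j).integral_steinDiv hv
  have hsumi : Integrable (fun x => ∑ i, Z i x ^ 2 / c) (isoGaussian n (σ ^ 2)) :=
    integrable_finsetSum Finset.univ fun i _ => (hZsq i).div_const c
  have i1 : Integrable (fun x => ‖G j x‖ ^ 2 - 2 * Z j x) (isoGaussian n (σ ^ 2)) :=
    hGj.sub (hZj.const_mul 2)
  have i2 : Integrable (fun x => ∑ i, Z i x ^ 2 / c + c) (isoGaussian n (σ ^ 2)) :=
    hsumi.add (integrable_const c)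
  set F : EuclideanSpace ℝ (Fin n) → ℝ := fun x =>
    (‖G j x‖ ^ 2 - 2 * Z j x) + (∑ i, Z i x ^ 2 / c + c)
  have hFi : Integrable F (isoGaussian n (σ ^ 2)) := i1.add i2
  have hFX : Integrable (fun ω => F (X ω)) P := by
    have h := hFi
    rw [← hX.map_eq] at h
    exact h.comp_aemeasurable hX.aemeasurable
  have hFX2 : ∫ ω, F (X ω) ∂P = ∫ x, F x ∂isoGaussian n (σ ^ 2) :=
    hX.integral_comp hFi.aestronglyMeasurable
  have hle : ∀ᵐ ω ∂P, ‖G (k ω) (X ω)‖ ^ 2 ≤ F (X ω) := by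
    filter_upwards [hk] with ω hω
    have h1 := hω j
    have h2 : Z (k ω) (X ω) ^ 2 / c ≤ ∑ i, Z i (X ω) ^ 2 / c :=
      Finset.single_le_sum (f := fun i => Z i (X ω) ^ 2 / c) (fun i _ => by positivity)
        (Finset.mem_univ (k ω))
    have h3 : 0 ≤ (Z (k ω) (X ω) - c) ^ 2 / c := by positivity
    have h4 : (Z (k ω) (X ω) - c) ^ 2 / c =
        Z (k ω) (X ω) ^ 2 / c + c - 2 * Z (k ω) (X ω) := by field_simp; ring
    simp only [F, Z] at *
    linarith
  have hF : ∫ x, F x ∂isoGaussian n (σ ^ 2) ≤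
      ∫ x, ‖G j x‖ ^ 2 ∂isoGaussian n (σ ^ 2) + (m * (2 * n * L ^ 2 * σ ^ 4 / c) + c) := by
    simp only [F]
    rw [integral_add i1 i2, integral_sub hGj (hZj.const_mul 2), integral_const_mul, hZj0,
      integral_add hsumi (integrable_const c),
      integral_finsetSum _ fun i _ => (hZsq i).div_const c]
    simp only [integral_const, probReal_univ, one_smul, mul_zero, sub_zero, integral_div]
    gcongr
    calc ∑ i, (∫ x, Z i x ^ 2 ∂isoGaussian n (σ ^ 2)) / c
        ≤ ∑ _i : Fin m, 2 * n * L ^ 2 * σ ^ 4 / c :=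
          Finset.sum_le_sum fun i _ => by
            have := hZ1 i
            gcongr
      _ = _ := by simp
  have hmain := integral_mono_ae (memLp_two_norm_tuned hσ hX hG hkm).integrable_sq hFX hle
  rw [hFX2] at hmain
  have e : m * (2 * n * L ^ 2 * σ ^ 4 / c) = 2 * n * m * L ^ 2 * σ ^ 4 / c := by ring
  linarith

end Tuning

/-! ### Reduction to centred noise -/

section Translation

variable {n : ℕ} {L : ℝ≥0}

lemma LipschitzWith.comp_const_add_sub_const
    {f : EuclideanSpace ℝ (Fin n) → EuclideanSpace ℝ (Fin n)} (hf : LipschitzWith L f)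
    (a b : EuclideanSpace ℝ (Fin n)) : LipschitzWith L fun x => f (a + x) - b := by
  refine LipschitzWith.of_dist_le_mul fun x y => ?_
  rw [dist_sub_right, ← dist_add_left a x y]
  exact hf.dist_le_mul _ _

lemma gradMatrix_comp_const_add_sub_const
    (f : EuclideanSpace ℝ (Fin n) → EuclideanSpace ℝ (Fin n)) (a b x : EuclideanSpace ℝ (Fin n)) :
    gradMatrix (fun x => f (a + x) - b) x = gradMatrix f (a + x) := by
  rw [gradMatrix, gradMatrix, fderiv_sub_const, fderiv_comp_add_left]

lemma measurable_trace_gradMatrix_sq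
    (f : EuclideanSpace ℝ (Fin n) → EuclideanSpace ℝ (Fin n)) :
    Measurable fun x => (gradMatrix f x ^ 2).trace := by
  simp only [pow_two, Matrix.trace, Matrix.diag, Matrix.mul_apply]
  exact Finset.measurable_sum _ fun a _ => Finset.measurable_sum _ fun i _ =>
    (measurable_gradMatrix_apply f a i).mul (measurable_gradMatrix_apply f i a)

end Translation

theorem mainTheorem6 :
    ∃ C : ℝ, 0 < C ∧
    ∀ (n m : ℕ) (L : ℝ≥0) (σ : ℝ) (_hσ : 0 < σ)
      (Ω : Type*) [MeasurableSpace Ω] (P : Measure Ω) [IsProbabilityMeasure P]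
      -- the model `y = μ + ε` with `ε ∼ N(0, σ² I_n)`
      (μ : EuclideanSpace ℝ (Fin n)) (ε y : Ω → EuclideanSpace ℝ (Fin n))
      (_hε : HasLaw ε (multivariateGaussian 0 (σ ^ 2 • (1 : Matrix (Fin n) (Fin n) ℝ))) P)
      (_hy : ∀ ω, y ω = μ + ε ω)
      -- the `L`-Lipschitz estimators
      (μhat : Fin m → EuclideanSpace ℝ (Fin n) → EuclideanSpace ℝ (Fin n))
      (_hL : ∀ j, LipschitzWith L (μhat j))
      -- `khat` minimizes SURE (ties broken in any measurable way), `μtilde` is the tuned estimate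
      (khat : Ω → Fin m) (_hkm : Measurable khat)
      (_hk : ∀ᵐ ω ∂P, ∀ j, sure σ (μhat (khat ω)) (y ω) ≤ sure σ (μhat j) (y ω))
      (μtilde : Ω → EuclideanSpace ℝ (Fin n)) (_hμ : ∀ ω, μtilde ω = μhat (khat ω) (y ω))
      -- `j₀` minimizes the risk
      (j₀ : Fin m)
      (_hj₀ : ∀ j, ∫ ω, ‖μhat j₀ (y ω) - μ‖ ∂P ≤ ∫ ω, ‖μhat j (y ω) - μ‖ ∂P),
    -- (i)
    (∀ α ∈ Set.Ioo (0 : ℝ) 1,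
      1 - α ≤ P.real {ω | ‖μtilde ω - μ‖ - ‖μhat j₀ (y ω) - μ‖ ≤
        σ * max ((8 * sStar P y μhat j₀ * m / α) ^ (1 / 4 : ℝ))
          ((8 * m * (√2 * L + 1) / α) ^ (1 / 2 : ℝ))}) ∧
    -- (ii)
    (∀ δ ∈ Set.Ioo (0 : ℝ) 1,
      1 - δ ≤ P.real {ω | ‖μhat j₀ (y ω) - μ‖ - ⨅ j, ‖μhat j (y ω) - μ‖ ≤
        2 * L * σ * √(2 * Real.log (m / δ))}) ∧
    -- (i) and (ii) together
    (∀ α ∈ Set.Ioo (0 : ℝ) 1, ∀ δ ∈ Set.Ioo (0 : ℝ) 1,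
      1 - α - δ ≤ P.real {ω | ‖μtilde ω - μ‖ - ⨅ j, ‖μhat j (y ω) - μ‖ ≤
        σ * max ((8 * sStar P y μhat j₀ * m / α) ^ (1 / 4 : ℝ))
          ((8 * m * (√2 * L + 1) / α) ^ (1 / 2 : ℝ)) +
        2 * L * σ * √(2 * Real.log (m / δ))}) ∧
    -- (iii)
    (MemLp (fun ω => ‖μtilde ω - μ‖ - ⨅ j, ‖μhat j (y ω) - μ‖) 2 P ∧
      (∫ ω, (‖μtilde ω - μ‖ - ⨅ j, ‖μhat j (y ω) - μ‖) ^ 2 ∂P) ^ (1 / 2 : ℝ) ≤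
        C * σ * ((sStar P y μhat j₀ * m) ^ (1 / 4 : ℝ) + (1 + L) * (m : ℝ) ^ (1 / 2 : ℝ))) ∧
    -- (iv)
    ((∀ j, (∫ ω, ‖μhat j (y ω) - μ‖ ^ 2 ∂P) / n ≤ L ^ 2 * σ ^ 2) →
      Integrable (fun ω => ‖μtilde ω - μ‖ ^ 2) P ∧
      (∫ ω, ‖μtilde ω - μ‖ ^ 2 ∂P) - ⨅ j, ∫ ω, ‖μhat j (y ω) - μ‖ ^ 2 ∂P ≤
        L * σ ^ 2 * (32 * n * m : ℝ) ^ (1 / 2 : ℝ)) := by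
  -- The constant produced by `sure_tuning_moment`.
  refine ⟨17, by norm_num, ?_⟩
  intro n m L σ hσ Ω _ P _ μ ε y hε hy μhat hL khat hkm hk μtilde hμ j₀ hj₀
  obtain rfl : y = fun ω => μ + ε ω := funext hy
  obtain rfl : μtilde = fun ω => μhat (khat ω) (μ + ε ω) := funext hμ
  have hv : 0 < σ ^ 2 := by positivity
  have hm1 : 1 ≤ m := j₀.pos
  have hm : (1 : ℝ) ≤ m := by exact_mod_cast hm1
  have hne : Nonempty (Fin m) := ⟨j₀⟩
  set G : Fin m → EuclideanSpace ℝ (Fin n) → EuclideanSpace ℝ (Fin n) :=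
    fun j x => μhat j (μ + x) - μ with hGdef
  have hG : ∀ j, LipschitzWith L (G j) := fun j => (hL j).comp_const_add_sub_const μ μ
  have hgrad : ∀ j x, gradMatrix (μhat j) (μ + x) = gradMatrix (G j) x := fun j x =>
    (gradMatrix_comp_const_add_sub_const (μhat j) μ μ x).symm
  have hX : HasLaw ε (isoGaussian n (σ ^ 2)) P := hε
  have hnorm : ∀ j ω, ‖μhat j (μ + ε ω) - μ‖ = ‖G j (ε ω)‖ := fun j ω => rfl
  have hint1 : ∀ j, ∫ ω, ‖G j (ε ω)‖ ∂P = ∫ x, ‖G j x‖ ∂isoGaussian n (σ ^ 2) := fun j =>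
    hX.integral_comp (f := fun x => ‖G j x‖) (hG j).continuous.norm.aestronglyMeasurable
  have hint2 : ∀ j, ∫ ω, ‖G j (ε ω)‖ ^ 2 ∂P = ∫ x, ‖G j x‖ ^ 2 ∂isoGaussian n (σ ^ 2) := fun j =>
    hX.integral_comp (f := fun x => ‖G j x‖ ^ 2)
      ((hG j).continuous.norm.pow 2).aestronglyMeasurable
  -- The last summand does not depend on `j`, so it cancels in comparisons of SURE values.
  have hsure : ∀ j ω, sure σ (μhat j) (μ + ε ω) =
      ‖G j (ε ω)‖ ^ 2 - 2 * steinDiv (σ ^ 2) (G j) (ε ω) + (‖ε ω‖ ^ 2 - n * σ ^ 2) := by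
    intro j ω
    have e : μhat j (μ + ε ω) - (μ + ε ω) = G j (ε ω) - ε ω := by simp only [hGdef]; abel
    rw [sure, hgrad, e, norm_sub_sq_real, steinDiv, real_inner_comm]
    ring
  have hk' : ∀ᵐ ω ∂P, ∀ j, ‖G (khat ω) (ε ω)‖ ^ 2 - 2 * steinDiv (σ ^ 2) (G (khat ω)) (ε ω) ≤
      ‖G j (ε ω)‖ ^ 2 - 2 * steinDiv (σ ^ 2) (G j) (ε ω) := by
    filter_upwards [hk] with ω hω j
    have := hω j
    rw [hsure, hsure] at this
    linarith
  have hj₀' : ∀ j, ∫ x, ‖G j₀ x‖ ∂isoGaussian n (σ ^ 2) ≤ ∫ x, ‖G j x‖ ∂isoGaussian n (σ ^ 2) :=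
    fun j => by rw [← hint1, ← hint1]; exact hj₀ j
  set s := sStar P (fun ω => μ + ε ω) μhat j₀ with hsdef
  have hsle : ∀ j, ∫ ω, ((gradMatrix (μhat j) (μ + ε ω) -
      gradMatrix (μhat j₀) (μ + ε ω)) ^ 2).trace ∂P ≤ s := fun j =>
    le_ciSup (f := fun j => ∫ ω, ((gradMatrix (μhat j) (μ + ε ω) -
      gradMatrix (μhat j₀) (μ + ε ω)) ^ 2).trace ∂P) (Set.finite_range _).bddAbove j
  -- The index `j₀` itself contributes the trace of the zero matrix.
  have hs0 : 0 ≤ s := by simpa using hsle j₀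
  have hs : ∀ j, ∫ x, (gradMatrix (fun z => G j z - G j₀ z) x ^ 2).trace
      ∂isoGaussian n (σ ^ 2) ≤ s := by
    intro j
    refine le_trans (le_of_eq ?_) (hsle j)
    rw [← hX.integral_comp (measurable_trace_gradMatrix_sq _).aestronglyMeasurable]
    refine integral_congr_ae ?_
    have hd : ∀ᵐ x ∂P.map ε, DifferentiableAt ℝ (G j) x ∧ DifferentiableAt ℝ (G j₀) x := by
      rw [hX.map_eq]
      exact ((hG j).ae_differentiableAt_isoGaussian hv).and
        ((hG j₀).ae_differentiableAt_isoGaussian hv)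
    filter_upwards [ae_of_ae_map hX.aemeasurable hd] with ω hω
    simp only [Function.comp_apply, gradMatrix_sub hω.1 hω.2, hgrad]
  simp only [hnorm]
  have hi := fun α (hα : α ∈ Set.Ioo (0 : ℝ) 1) => sure_tuning_tail hσ hX hG hk' hs0 hs hα
  have hii := fun δ (hδ : δ ∈ Set.Ioo (0 : ℝ) 1) => best_risk_tail hσ hX hG hj₀' hδ
  have hAt := aemeasurable_norm_tuned hX hG hkm
  have hAm := aemeasurable_iInf_norm hX hG
  have hA0 := (memLp_two_norm_comp hσ hX hG j₀).aestronglyMeasurable.aemeasurable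
  refine ⟨hi, hii, fun α hα δ hδ => ?_, ⟨memLp_two_tuned_sub_iInf hσ hX hG hkm, ?_⟩, fun hrisk =>
    ⟨(memLp_two_norm_tuned hσ hX hG hkm).integrable_sq, ?_⟩⟩
  · refine one_sub_sub_le_measureReal (hi α hα) (hii δ hδ)
      (nullMeasurableSet_le (hAt.sub hA0) aemeasurable_const)
      (nullMeasurableSet_le (hA0.sub hAm) aemeasurable_const) fun ω hω => ?_
    have h1 := hω.1
    have h2 := hω.2
    simp only [Set.mem_ofPred_eq] at h1 h2 ⊢
    linarith
  · have hsm : 0 ≤ s * m := by positivity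
    have h4 : ((s * m) ^ (1 / 4 : ℝ)) ^ 4 = s * m := by
      rw [← Real.rpow_natCast, ← Real.rpow_mul hsm]; norm_num
    have h2 : ((1 + L) * (m : ℝ) ^ (1 / 2 : ℝ)) ^ 2 = (1 + L) ^ 2 * m := by
      rw [mul_pow, ← Real.rpow_natCast ((m : ℝ) ^ (1 / 2 : ℝ)), ← Real.rpow_mul (by positivity)]
      norm_num
    have h := sure_tuning_moment hσ hX hG hkm hk' hj₀' hs0 hs
      (a := (s * m) ^ (1 / 4 : ℝ)) (b := (1 + L) * (m : ℝ) ^ (1 / 2 : ℝ)) (by positivity) h4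
      (by positivity) h2
    rw [← Real.sqrt_eq_rpow]
    exact Real.sqrt_le_iff.2 ⟨by positivity, h⟩
  · have hrisk' : ∀ j, ∫ x, ‖G j x‖ ^ 2 ∂isoGaussian n (σ ^ 2) ≤ n * (L ^ 2 * σ ^ 2) := by
      intro j
      -- For `n = 0` the hypothesis divides by zero and says nothing, but then every norm vanishes.
      rcases Nat.eq_zero_or_pos n with rfl | hn
      · simp [Subsingleton.elim _ (0 : EuclideanSpace ℝ (Fin 0))]
      · have h := hrisk j
        rw [div_le_iff₀ (by exact_mod_cast hn), hint2] at h
        linarith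
    obtain ⟨j, hj⟩ := exists_eq_ciInf_of_finite (f := fun j => ∫ ω, ‖G j (ε ω)‖ ^ 2 ∂P)
    rw [← hj, hint2]
    refine (sure_tuning_risk hσ hX hG hkm hk' hrisk' j).trans ?_
    rw [← Real.sqrt_eq_rpow]
    have hL0 : (0 : ℝ) ≤ L := L.2
    have e : L * σ ^ 2 * √(32 * n * m) = √((L * σ ^ 2) ^ 2 * (32 * n * m)) := by
      rw [Real.sqrt_mul (sq_nonneg _), Real.sqrt_sq (by positivity)]
    have e2 : 2 * √(2 * n * m * L ^ 2 * σ ^ 4) = √(2 ^ 2 * (2 * n * m * L ^ 2 * σ ^ 4)) := by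
      rw [Real.sqrt_mul (sq_nonneg _), Real.sqrt_sq (by norm_num)]
    rw [e, e2]
    -- The bound obtained has `8 n m` under the root, and `8 ≤ 32`.
    refine Real.sqrt_le_sqrt ?_
    have h0 : 0 ≤ n * m * (L : ℝ) ^ 2 * σ ^ 4 := by positivity
    linarith
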